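/- Let $\Lambda=(\lambda_n)_{n\ge 0}$ be a quasi-geometric sequence: $\lambda_n>0$ for all $n$ and there are constants $r,R$ with $1<r\le \lambda_{n+1}/\lambda_n\le R<\infty$ for all $n$. Let $M_\Lambda^2$ be the closed linear span of the monomials $t^{\lambda_n}$, $n\ge 0$, in the complex space $L^2([0,1])$ (Lebesgue measure); each $f\in M_\Lambda^2$ is identified with its representative of the form $f(t)=\sum_n a_nt^{\lambda_n}$, convergent at every $t\in[0,1)$. For a finite positive Borel measure $\mu$ on $[0,1)$ let $i_\mu^2:M_\Lambda^2\to L^2(\mu)$, $f\mapsto f$, be the Carleson embedding, whenever it is defined and bounded. For a bounded operator $S$ between Hilbert spaces put $a_n(S)=\inf\{\|S-R\|:\operatorname{rank}R<n\}$ for $n\ge1$; $S$ is Hilbert–Schmidt if $\|S\|_{\mathcal S^2}:=\big(\sum_{n\ge1}a_n(S)^2\big)^{1/2}<\infty$. (a) For every finite positive Borel measure $\mu$ on $[0,1)$, the following are equivalent: (i) $i_\mu^2$ is a (well-defined, bounded and) Hilbert–Schmidt operator; (ii) $\int_{[0,1)}\frac{1}{1-t}\,d\mu(t)<\infty$. (b)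 There is a constant $C>0$ depending only on $\Lambda$ and, for every $\delta\in(0,1)$, a constant $c>0$ depending only on $\Lambda$ and $\delta$, such that for every finite positive Borel measure $\mu$ on $[0,1)$ for which $i_\mu^2$ is Hilbert–Schmidt, $$c\Big(\int_{[\delta,1)}\frac{d\mu(t)}{1-t}\Big)^{1/2}\le \|i_\mu^2\|_{\mathcal S^2}\le C\Big(\int_{[0,1)}\frac{d\mu(t)}{1-t}\Big)^{1/2}.$$ In particular $\|i_\mu^2\|_{\mathcal S^2}\approx\big(\int_{[0,1)}\frac{d\mu(t)}{1-t}\big)^{1/2}$ for measures $\mu$ carried by $[\delta,1)$, with constants depending only on $\Lambda$ and $\delta$. -/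

import Mathlib

open MeasureTheory Set

noncomputable section

/-- A sequence of positive numbers whose consecutive ratios stay in some `[r, R]`, `1 < r`. -/
def IsQuasiGeometric (u : ℕ → ℝ) : Prop :=
  (∀ n, 0 < u n) ∧
    ∃ r R : ℝ, 1 < r ∧ ∀ n, r ≤ u (n + 1) / u n ∧ u (n + 1) / u n ≤ R

/-- The complex Hilbert space `L²([0,1])` for Lebesgue measure. -/
abbrev LebesgueL2 : Type :=
  Lp ℂ 2 ((volume : Measure ℝ).restrict (Icc 0 1))

/-- The Müntz space `M_Λ²`: the closed linear span in `L²([0,1])` of the (classes of the)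
monomials `t ^ Λ n`. -/
def muntzSpace (Λ : ℕ → ℝ) : Submodule ℂ LebesgueL2 :=
  (Submodule.span ℂ
    {f : LebesgueL2 | ∃ n, f =ᵐ[(volume : Measure ℝ).restrict (Icc 0 1)]
      fun t : ℝ => ((t ^ Λ n : ℝ) : ℂ)}).topologicalClosure

/-- `g` gives the pointwise values on `[0,1)` of `f ∈ M_Λ²`: it is a representative of `f` which is
the sum of a series `∑ aₙ t ^ Λ n` at every point of `[0,1)`. -/
def IsMuntzRepresentative (Λ : ℕ → ℝ) (f : muntzSpace Λ) (g : ℝ → ℂ) : Prop :=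
  (f : LebesgueL2) =ᵐ[(volume : Measure ℝ).restrict (Icc 0 1)] g ∧
    ∃ a : ℕ → ℂ, ∀ t ∈ Ico (0 : ℝ) 1, HasSum (fun n => a n * ((t ^ Λ n : ℝ) : ℂ)) (g t)

/-- The bounded operator `T` is the Carleson embedding `M_Λ² → L²(μ)`, `f ↦ f`, where `f` is
regarded as a function on `[0,1)` through its pointwise values. -/
def IsCarlesonEmbedding (Λ : ℕ → ℝ) (μ : Measure ℝ) (T : muntzSpace Λ →L[ℂ] Lp ℂ 2 μ) : Prop :=
  ∀ f : muntzSpace Λ, ∃ g : ℝ → ℂ, IsMuntzRepresentative Λ f g ∧ T f =ᵐ[μ] g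

section Schatten

variable {E F : Type*} [NormedAddCommGroup E] [InnerProductSpace ℂ E]
  [NormedAddCommGroup F] [InnerProductSpace ℂ F]

/-- The `n`-th approximation number (`n ≥ 1`): the distance from `S` to the bounded operators of
rank `< n`. -/
def approxNumber (S : E →L[ℂ] F) (n : ℕ) : ℝ :=
  sInf {d : ℝ | ∃ R : E →L[ℂ] F, (R : E →ₗ[ℂ] F).rank < (n : Cardinal) ∧ d = ‖S - R‖}

/-- `S` belongs to the Schatten class `S^r`: `∑_{n ≥ 1} aₙ(S) ^ r < ∞`. -/
def MemSchatten (S : E →L[ℂ] F) (r : ℝ) : Prop :=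
  Summable fun n : ℕ => approxNumber S (n + 1) ^ r

/-- The Schatten norm `(∑_{n ≥ 1} aₙ(S) ^ r) ^ (1 / r)` of `S ∈ S^r`. -/
def schattenNorm (S : E →L[ℂ] F) (r : ℝ) : ℝ :=
  (∑' n : ℕ, approxNumber S (n + 1) ^ r) ^ (1 / r)

/-- Hilbert–Schmidt operators: the Schatten class `S²`. -/
def IsHilbertSchmidt (S : E →L[ℂ] F) : Prop := MemSchatten S 2

end Schatten

end

noncomputable section

/-! ### Approximation numbers, orthogonal vectors and Bessel families. -/

section Approximation

variable {E F : Type*} [NormedAddCommGroup E] [InnerProductSpace ℂ E]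
  [NormedAddCommGroup F] [InnerProductSpace ℂ F]

/-! The sum of the squared approximation numbers is trapped between two integrals against `μ`.

Upper bound. If evaluation at `t` has norm at most `K / √(1 - t)` on the Müntz space, duality gives
`∑ |xᵢ(t)|² ≤ K² / (1 - t)` for orthogonal `xᵢ` in the unit ball. Integrating bounds `∑ ‖T xᵢ‖²`,
and such `xᵢ` can be chosen greedily with `aᵢ₊₁(T) ≤ 2 ‖T xᵢ‖`. The evaluation bound
(`exists_muntz_evaluation`) combines the coefficient bound `|aₙ| ≤ C √Λₙ ‖f‖` with `∑ √Λₙ t ^ Λₙ ≤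
C' / √(1 - t)`. For the coefficients (`norm_coeff_le`), put `wₙ = Λₙ + 1/2`: the monomials have Gram
matrix `1 / (wᵢ + wⱼ)`, a Szegő kernel of the half-plane, so multiplying coefficients by values of a
Blaschke product is contractive. The product vanishing at every other `wₖ` isolates `aₙ`, and
lacunarity keeps its value at `wₙ` away from zero.

Lower bound. The functions `√wₙ t ^ Λₙ` have a geometrically decaying Gram matrix, hence form a
Bessel family, which a Hilbert–Schmidt operator maps to a square summable one
(`sum_norm_sq_le_tsum_approxNumber`). The sum of squares is `∫ ∑ wₙ t ^ (2 Λₙ) dμ`, and on `[δ, 1)`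
the single term with `Λₙ` comparable to `1 / (1 - t)` already dominates `c / (1 - t)`; the upper
ratio `R` provides such a term. -/

theorem bddBelow_approxNumber_set (S : E →L[ℂ] F) (n : ℕ) :
    BddBelow {d : ℝ | ∃ R : E →L[ℂ] F, (R : E →ₗ[ℂ] F).rank < (n : Cardinal) ∧ d = ‖S - R‖} :=
  ⟨0, by rintro d ⟨R, -, rfl⟩; exact norm_nonneg _⟩

theorem approxNumber_nonneg (S : E →L[ℂ] F) (n : ℕ) : 0 ≤ approxNumber S n :=
  Real.sInf_nonneg (by rintro d ⟨R, -, rfl⟩; exact norm_nonneg _)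

theorem approxNumber_le (S R : E →L[ℂ] F) {n : ℕ} (hR : (R : E →ₗ[ℂ] F).rank < (n : Cardinal)) :
    approxNumber S n ≤ ‖S - R‖ :=
  csInf_le (bddBelow_approxNumber_set S n) ⟨R, hR, rfl⟩

theorem le_approxNumber (S : E →L[ℂ] F) (n : ℕ) {d : ℝ}
    (h : ∀ R : E →L[ℂ] F, (R : E →ₗ[ℂ] F).rank < ((n + 1 : ℕ) : Cardinal) → d ≤ ‖S - R‖) :
    d ≤ approxNumber S (n + 1) := by
  refine le_csInf ⟨‖S - 0‖, 0, ?_, rfl⟩ ?_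
  · have : ((0 : E →L[ℂ] F) : E →ₗ[ℂ] F).rank = 0 := by
      rw [ContinuousLinearMap.toLinearMap_zero, LinearMap.rank_zero]
    rw [this]
    exact_mod_cast Nat.succ_pos n
  · rintro _ ⟨R, hR, rfl⟩
    exact h R hR

/-- In the orthogonal complement of an `n`-dimensional space, `T` almost attains its
approximation number. -/
theorem exists_mem_orthogonal_approxNumber_le (T : E →L[ℂ] F) (K : Submodule ℂ E)
    [FiniteDimensional ℂ K] {n : ℕ} (hK : Module.finrank ℂ K ≤ n) :
    ∃ x ∈ Kᗮ, ‖x‖ ≤ 1 ∧ approxNumber T (n + 1) ≤ 2 * ‖T x‖ := by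
  have h1 : approxNumber T (n + 1) ≤ ‖T - T.comp K.starProjection‖ := by
    refine approxNumber_le _ _ ?_
    rw [ContinuousLinearMap.toLinearMap_comp]
    have h2 : (K.starProjection : E →ₗ[ℂ] E).rank ≤ Module.rank ℂ K := by
      refine Submodule.rank_mono (show LinearMap.range (K.starProjection : E →ₗ[ℂ] E) ≤ K from ?_)
      rintro _ ⟨y, rfl⟩
      exact Submodule.starProjection_apply_mem K y
    have h3 : (K.starProjection : E →ₗ[ℂ] E).rank ≤ n := by
      refine h2.trans ?_
      rw [← Module.finrank_eq_rank]
      exact_mod_cast hK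
    have h4 := (LinearMap.lift_rank_comp_le_right (K.starProjection : E →ₗ[ℂ] E)
      (T : E →ₗ[ℂ] F)).trans (Cardinal.lift_le.2 h3)
    rw [Cardinal.lift_natCast, Cardinal.lift_le_nat_iff] at h4
    exact h4.trans_lt (by exact_mod_cast Nat.lt_succ_self n)
  -- Half the approximation number lies strictly below the operator norm only when it is positive.
  rcases (approxNumber_nonneg T (n + 1)).eq_or_lt with h0 | h0
  · exact ⟨0, Submodule.zero_mem _, by simp, by simp [← h0]⟩
  · obtain ⟨x, hx, hTx⟩ := ContinuousLinearMap.exists_lt_apply_of_lt_opNorm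
      (T - T.comp K.starProjection) (r := approxNumber T (n + 1) / 2) (by linarith)
    refine ⟨x - K.starProjection x, Submodule.sub_starProjection_mem_orthogonal x, ?_, ?_⟩
    · have : x - K.starProjection x = Kᗮ.starProjection x := by
        rw [Submodule.starProjection_orthogonal']; simp
      rw [this]
      exact (Submodule.norm_starProjection_apply_le _ _).trans hx.le
    · have : (T - T.comp K.starProjection) x = T (x - K.starProjection x) := by simp
      rw [this] at hTx
      linarith

/-- Orthogonal vectors of norm at most one on which `T` is bounded below by half of its
approximation numbers. -/
theorem exists_orthogonal_approxNumber_le (T : E →L[ℂ] F) (N : ℕ) :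
    ∃ x : ℕ → E, (∀ i < N, ‖x i‖ ≤ 1) ∧ (∀ i < N, ∀ j < N, i ≠ j → inner ℂ (x i) (x j) = 0) ∧
      ∀ i < N, approxNumber T (i + 1) ≤ 2 * ‖T (x i)‖ := by
  induction N with
  | zero => exact ⟨0, by simp, by simp, by simp⟩
  | succ N ih =>
    obtain ⟨x, h1, h2, h3⟩ := ih
    classical
    set K := Submodule.span ℂ (((Finset.range N).image x : Finset E) : Set E) with hK
    have hfr : Module.finrank ℂ K ≤ N :=
      (finrank_span_finset_le_card _).trans (Finset.card_image_le.trans (by simp))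
    obtain ⟨y, hy, hy1, hyT⟩ := exists_mem_orthogonal_approxNumber_le T K hfr
    have hxK : ∀ i < N, x i ∈ K := fun i hi =>
      Submodule.subset_span (by
        rw [Finset.coe_image]; exact ⟨i, by simpa using hi, rfl⟩)
    refine ⟨Function.update x N y, ?_, ?_, ?_⟩
    · intro i hi
      rcases Nat.lt_succ_iff_lt_or_eq.1 hi with h | rfl
      · simpa [h.ne] using h1 i h
      · simpa using hy1
    · intro i hi j hj hij
      rcases Nat.lt_succ_iff_lt_or_eq.1 hi with h | rfl <;>
      rcases Nat.lt_succ_iff_lt_or_eq.1 hj with h' | rfl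
      · simpa [h.ne, h'.ne] using h2 i h j h' hij
      · simpa [h.ne] using hy _ (hxK i h)
      · simpa [h'.ne] using Submodule.inner_left_of_mem_orthogonal (hxK j h') hy
      · exact absurd rfl hij
    · intro i hi
      rcases Nat.lt_succ_iff_lt_or_eq.1 hi with h | rfl
      · simpa [h.ne] using h3 i h
      · simpa using hyT

/-- A Bessel family is mapped by a Hilbert–Schmidt operator to a square summable family. -/
theorem sum_norm_sq_le_tsum_approxNumber [CompleteSpace F] (T : E →L[ℂ] F)
    (hT : IsHilbertSchmidt T) (g : ℕ → E) (N : ℕ) {B : ℝ}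
    (hB : ∀ x, ∑ k ∈ Finset.range N, ‖inner ℂ (g k) x‖ ^ 2 ≤ B * ‖x‖ ^ 2) (hB0 : 0 ≤ B) :
    ∑ k ∈ Finset.range N, ‖T (g k)‖ ^ 2 ≤ B * ∑' n, approxNumber T (n + 1) ^ (2 : ℝ) := by
  classical
  -- On the finite-dimensional span the spectral theorem applies to `S* S`, with no compactness of
  -- `T` needed.
  set V := Submodule.span ℂ (((Finset.range N).image g : Finset E) : Set E) with hV
  have : CompleteSpace V := FiniteDimensional.complete ℂ V
  set S : V →L[ℂ] F := T.comp V.subtypeL with hS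
  set A : V →ₗ[ℂ] V := ((ContinuousLinearMap.adjoint S).comp S).toLinearMap with hA
  have hAi : ∀ x y, inner ℂ x (A y) = inner ℂ (S x) (S y) := fun x y =>
    ContinuousLinearMap.adjoint_inner_right S x (S y)
  have hAs : A.IsSymmetric := fun x y => by
    rw [hAi, ← inner_conj_symm, hAi, inner_conj_symm]
  set b := hAs.eigenvectorBasis (n := Module.finrank ℂ V) rfl with hb
  set l := hAs.eigenvalues (n := Module.finrank ℂ V) rfl with hl
  have hbA : ∀ i, A (b i) = (l i : ℂ) • b i := hAs.apply_eigenvectorBasis rfl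
  have hanti : Antitone l := hAs.eigenvalues_antitone rfl
  have hSx : ∀ x : V, ‖T x‖ ^ 2 = ∑ i, l i * ‖inner ℂ (b i) x‖ ^ 2 := by
    intro x
    have h1 : ((‖T x‖ ^ 2 : ℝ) : ℂ) = inner ℂ x (A x) := by
      rw [hAi, inner_self_eq_norm_sq_to_K]; simp [hS]
    have h2 : (inner ℂ x (A x) : ℂ) = ∑ i, inner ℂ x (b i) * inner ℂ (b i) (A x) :=
      (b.sum_inner_mul_inner x (A x)).symm
    have h3 : (inner ℂ x (A x) : ℂ) = ((∑ i, l i * ‖inner ℂ (b i) x‖ ^ 2 : ℝ) : ℂ) := by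
      rw [h2]; push_cast
      refine Finset.sum_congr rfl fun i _ => ?_
      rw [← hAs (b i) x, hbA, inner_smul_left, ← inner_conj_symm x (b i)]
      have : (starRingEnd ℂ) (inner ℂ (b i) x) * inner ℂ (b i) x
          = ((‖(inner ℂ (b i) x : ℂ)‖ : ℂ)) ^ 2 := by
        rw [mul_comm, Complex.mul_conj, Complex.normSq_eq_norm_sq]; push_cast; rfl
      rw [← this]; simp; ring
    rw [h3] at h1
    exact_mod_cast h1
  have hnorm : ∀ x : V, ‖x‖ ^ 2 = ∑ i, ‖(inner ℂ (b i) x : ℂ)‖ ^ 2 := fun x =>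
    (b.sum_sq_norm_inner_right x).symm
  have hl0 : ∀ i, l i = ‖T (b i)‖ ^ 2 := by
    intro i
    rw [hSx, Finset.sum_eq_single i]
    · simp
    · intro j _ hj
      rw [b.inner_eq_zero hj]; simp
    · simp
  have key : ∀ i, l i ≤ approxNumber T (i + 1) ^ 2 := by
    intro i
    have hs : Real.sqrt (l i) ≤ approxNumber T (i + 1) := by
      -- Min-max: `R` has rank at most `i`, while the eigenvectors `0, …, i` span `i + 1`
      -- dimensions. So `R` kills some nonzero combination `x` of them, and there `‖T x‖² ≥ l i
      -- ‖x‖²`.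
      refine le_approxNumber T i fun R hR => ?_
      obtain ⟨x, hx0, hxR, hxi⟩ : ∃ x : V, x ≠ 0 ∧ R x = 0 ∧
          ∀ j, i < j → (inner ℂ (b j) x : ℂ) = 0 := by
        set L : (Iic i → ℂ) →ₗ[ℂ] V :=
          Fintype.linearCombination ℂ (fun j : Iic i => b j) with hL
        have hLa : ∀ c, L c = ∑ j : Iic i, c j • b j := fun c => by
          rw [hL, Fintype.linearCombination_apply]
        have hLinj : ∀ c, L c = 0 → c = 0 := by
          intro c hc
          have := (b.orthonormal.linearIndependent.comp (fun j : Iic i => (j : Fin _))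
            Subtype.val_injective)
          rw [Fintype.linearIndependent_iff] at this
          funext j
          exact this c ((hLa c).symm.trans hc) j
        have hni : ¬ Function.Injective ((R : E →ₗ[ℂ] F) ∘ₗ V.subtype ∘ₗ L) := by
          intro hinj
          have h2 : ((R : E →ₗ[ℂ] F) ∘ₗ V.subtype ∘ₗ L).rank ≤ (R : E →ₗ[ℂ] F).rank :=
            LinearMap.rank_comp_le_left _ _
          have h3 := h2.trans_lt hR
          have h4 := lift_rank_range_of_injective _ hinj
          have h5 : Module.rank ℂ (Iic i → ℂ) = ((i + 1 : ℕ) : Cardinal) := by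
            rw [rank_fun']; simp
          rw [h5, Cardinal.lift_natCast, Cardinal.lift_eq_nat_iff] at h4
          exact h3.ne h4
        rw [← LinearMap.ker_eq_bot, Submodule.eq_bot_iff] at hni
        push Not at hni
        obtain ⟨c, hc, hc0⟩ := hni
        refine ⟨L c, fun h => hc0 (hLinj c h), hc, fun j hj => ?_⟩
        rw [hLa, inner_sum]
        refine Finset.sum_eq_zero fun k _ => ?_
        rw [inner_smul_right, b.inner_eq_zero, mul_zero]
        rintro rfl
        exact absurd k.2 (not_le.2 hj)
      have h1 : l i * ‖x‖ ^ 2 ≤ ‖T x‖ ^ 2 := by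
        rw [hSx, hnorm, Finset.mul_sum]
        refine Finset.sum_le_sum fun j _ => ?_
        rcases le_or_gt j i with h | h
        · exact mul_le_mul_of_nonneg_right (hanti h) (by positivity)
        · simp [hxi j h]
      have h2 : ‖T x‖ ≤ ‖T - R‖ * ‖x‖ := by
        have := (T - R).le_opNorm x
        simpa [hxR] using this
      have hxp : 0 < ‖x‖ := norm_pos_iff.2 hx0
      refine Real.sqrt_le_iff.2 ⟨norm_nonneg _, ?_⟩
      have h3 : l i * ‖x‖ ^ 2 ≤ ‖T - R‖ ^ 2 * ‖x‖ ^ 2 := by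
        rw [← mul_pow]
        exact h1.trans (pow_le_pow_left₀ (norm_nonneg _) h2 2)
      exact le_of_mul_le_mul_right h3 (by positivity)
    rw [hl0]
    rw [hl0, Real.sqrt_sq (norm_nonneg _)] at hs
    exact pow_le_pow_left₀ (norm_nonneg _) hs 2
  have hgV : ∀ k ∈ Finset.range N, g k ∈ V := fun k hk =>
    Submodule.subset_span (by rw [Finset.coe_image]; exact ⟨k, hk, rfl⟩)
  -- Expanding in the eigenbasis and exchanging sums lets the Bessel bound act on each unit vector
  -- `b i`.
  have hsum : ∑ k ∈ Finset.range N, ‖T (g k)‖ ^ 2 ≤ ∑ i, l i * B := by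
    calc ∑ k ∈ Finset.range N, ‖T (g k)‖ ^ 2
        = ∑ k ∈ Finset.range N, ∑ i, l i * ‖(inner ℂ (g k) (b i : E) : ℂ)‖ ^ 2 := by
          refine Finset.sum_congr rfl fun k hk => ?_
          refine (hSx ⟨g k, hgV k hk⟩).trans ?_
          refine Finset.sum_congr rfl fun i _ => ?_
          rw [norm_inner_symm]
          rfl
      _ = ∑ i, l i * ∑ k ∈ Finset.range N, ‖(inner ℂ (g k) (b i : E) : ℂ)‖ ^ 2 := by
          rw [Finset.sum_comm]
          simp_rw [Finset.mul_sum]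
      _ ≤ ∑ i, l i * B := by
          refine Finset.sum_le_sum fun i _ => ?_
          refine mul_le_mul_of_nonneg_left ?_ (by rw [hl0]; positivity)
          refine (hB _).trans ?_
          have : ‖(b i : E)‖ = 1 := b.orthonormal.1 i
          simp [this]
  refine hsum.trans ?_
  rw [← Finset.sum_mul, mul_comm]
  refine mul_le_mul_of_nonneg_left ?_ hB0
  calc ∑ i, l i ≤ ∑ i : Fin (Module.finrank ℂ V), approxNumber T (i + 1) ^ (2 : ℝ) :=
        Finset.sum_le_sum fun i _ => by simpa using key i
    _ = ∑ n ∈ Finset.range (Module.finrank ℂ V), approxNumber T (n + 1) ^ (2 : ℝ) :=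
        Fin.sum_univ_eq_sum_range (fun n => approxNumber T (n + 1) ^ (2 : ℝ)) _
    _ ≤ _ := Summable.sum_le_tsum _ (fun n _ => Real.rpow_nonneg (approxNumber_nonneg _ _) _) hT

end Approximation

/-! ### Lacunary sequences and Blaschke products. -/

section Lacunary

theorem sum_pow_le_of_injOn {σ : ℝ} (h0 : 0 ≤ σ) (h1 : σ < 1) (s : Finset ℕ) (e : ℕ → ℕ)
    (he : InjOn e s) : ∑ i ∈ s, σ ^ e i ≤ 1 / (1 - σ) := by
  classical
  rw [← Finset.sum_image (f := fun k => σ ^ k) he, one_div, ← tsum_geometric_of_lt_one h0 h1]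
  exact (summable_geometric_of_lt_one h0 h1).sum_le_tsum _ fun _ _ => pow_nonneg h0 _

theorem sum_pow_dist_le {σ : ℝ} (h0 : 0 ≤ σ) (h1 : σ < 1) (s : Finset ℕ) (n : ℕ) :
    ∑ i ∈ s, σ ^ Nat.dist i n ≤ 2 / (1 - σ) := by
  rw [← Finset.sum_filter_add_sum_filter_not s (fun i => i ≤ n)]
  have h2 := sum_pow_le_of_injOn h0 h1 (s.filter fun i => i ≤ n) (fun i => Nat.dist i n) (by
    intro i hi j hj hij
    simp only [Finset.coe_filter, mem_ofPred_eq, Nat.dist] at hi hj hij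
    omega)
  have h3 := sum_pow_le_of_injOn h0 h1 (s.filter fun i => ¬ i ≤ n) (fun i => Nat.dist i n) (by
    intro i hi j hj hij
    simp only [Finset.coe_filter, mem_ofPred_eq, Nat.dist] at hi hj hij
    omega)
  have : 2 / (1 - σ) = 1 / (1 - σ) + 1 / (1 - σ) := by ring
  linarith

variable {w : ℕ → ℝ} {ρ : ℝ}

theorem le_pow_mul_of_lacunary (hρ : 0 ≤ ρ) (h : ∀ n, w n ≤ ρ * w (n + 1)) (i k : ℕ) :
    w i ≤ ρ ^ k * w (i + k) := by
  induction k with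
  | zero => simp
  | succ k ih =>
    calc w i ≤ ρ ^ k * w (i + k) := ih
      _ ≤ ρ ^ k * (ρ * w (i + k + 1)) := mul_le_mul_of_nonneg_left (h _) (pow_nonneg hρ _)
      _ = ρ ^ (k + 1) * w (i + (k + 1)) := by rw [pow_succ, mul_assoc]; rfl

theorem le_pow_dist_mul_of_lacunary (hρ : 0 ≤ ρ) (h : ∀ n, w n ≤ ρ * w (n + 1)) {i j : ℕ}
    (hij : i ≤ j) : w i ≤ ρ ^ Nat.dist i j * w j := by
  have := le_pow_mul_of_lacunary hρ h i (j - i)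
  rwa [Nat.add_sub_cancel' hij, ← Nat.dist_eq_sub_of_le hij] at this

theorem sqrt_mul_le_pow_dist (hρ : 0 ≤ ρ) (hw : ∀ n, 0 < w n) (h : ∀ n, w n ≤ ρ * w (n + 1))
    (i j : ℕ) : √(w i * w j) ≤ √ρ ^ Nat.dist i j * (w i + w j) := by
  wlog hij : i ≤ j generalizing i j
  · rw [Nat.dist_comm, mul_comm (w i), add_comm (w i)]
    exact this j i (le_of_not_ge hij)
  have h1 := le_pow_dist_mul_of_lacunary hρ h hij
  have hi := hw i
  have hj := hw j
  have h2 : √(w i * w j) ≤ √ρ ^ Nat.dist i j * w j := by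
    refine Real.sqrt_le_iff.2 ⟨by positivity, ?_⟩
    rw [mul_pow, ← pow_mul, mul_comm _ 2, pow_mul, Real.sq_sqrt hρ, pow_two (w j), ← mul_assoc]
    exact mul_le_mul_of_nonneg_right h1 hj.le
  refine h2.trans (mul_le_mul_of_nonneg_left (by linarith) (by positivity))

/-- With `x = ρ ^ dist`, the factor is at least `(1 - x) / (1 + x)`, whose inverse is `1 + 2x / (1 -
x) ≤ exp (2x / (1 - ρ))`. The exponential form turns products into summable exponents. -/
theorem exp_neg_le_blaschke (hρ : 0 ≤ ρ) (hρ1 : ρ < 1) (hw : ∀ n, 0 < w n)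
    (h : ∀ n, w n ≤ ρ * w (n + 1)) {i j : ℕ} (hij : i ≠ j) :
    Real.exp (-(2 / (1 - ρ) * ρ ^ Nat.dist i j)) ≤ |(w j - w i) / (w j + w i)| := by
  wlog hlt : i < j generalizing i j
  · have := this hij.symm (by omega)
    rwa [Nat.dist_comm, abs_div, abs_sub_comm, add_comm, ← abs_div] at this
  have h1 := le_pow_dist_mul_of_lacunary hρ h hlt.le
  have hi := hw i
  have hj := hw j
  have hx : ρ ^ Nat.dist i j ≤ ρ :=
    pow_le_of_le_one hρ hρ1.le (by rw [Nat.dist_eq_sub_of_le hlt.le]; omega)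
  have hx0 : 0 ≤ ρ ^ Nat.dist i j := pow_nonneg hρ _
  set x := ρ ^ Nat.dist i j
  have h2 : (1 - x) / (1 + x) ≤ (w j - w i) / (w j + w i) := by
    rw [div_le_div_iff₀ (by linarith) (by linarith)]
    nlinarith
  refine le_trans ?_ (h2.trans (le_abs_self _))
  have h3 : (1 + x) / (1 - x) ≤ Real.exp (2 / (1 - ρ) * x) := by
    refine le_trans ?_ (Real.add_one_le_exp _)
    have : 2 * x / (1 - x) ≤ 2 * x / (1 - ρ) :=
      div_le_div_of_nonneg_left (by linarith) (by linarith) (by linarith)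
    have h4 : (1 + x) / (1 - x) = 2 * x / (1 - x) + 1 := by
      have : 1 - x ≠ 0 := by linarith
      field_simp; ring
    rw [h4, div_mul_eq_mul_div]
    linarith
  rw [Real.exp_neg, ← inv_div (1 + x)]
  exact inv_anti₀ (div_pos (by linarith) (by linarith)) h3

theorem exp_neg_le_prod_blaschke (hρ : 0 ≤ ρ) (hρ1 : ρ < 1) (hw : ∀ n, 0 < w n)
    (h : ∀ n, w n ≤ ρ * w (n + 1)) {s : Finset ℕ} {n : ℕ} (hn : n ∉ s) :
    Real.exp (-(4 / (1 - ρ) ^ 2)) ≤ |∏ k ∈ s, (w n - w k) / (w n + w k)| := by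
  rw [Finset.abs_prod]
  calc Real.exp (-(4 / (1 - ρ) ^ 2))
      ≤ Real.exp (∑ k ∈ s, -(2 / (1 - ρ) * ρ ^ Nat.dist k n)) := by
        rw [Real.exp_le_exp, Finset.sum_neg_distrib, ← Finset.mul_sum, neg_le_neg_iff]
        have h1 : 0 < 1 - ρ := by linarith
        calc _ ≤ 2 / (1 - ρ) * (2 / (1 - ρ)) :=
              mul_le_mul_of_nonneg_left (sum_pow_dist_le hρ hρ1 s n) (by positivity)
          _ = _ := by field_simp; norm_num
    _ = ∏ k ∈ s, Real.exp (-(2 / (1 - ρ) * ρ ^ Nat.dist k n)) := Real.exp_sum _ _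
    _ ≤ _ := Finset.prod_le_prod (fun _ _ => (Real.exp_pos _).le) fun k hk =>
        exp_neg_le_blaschke hρ hρ1 hw h (by rintro rfl; exact hn hk)

end Lacunary

/-! ### Gram matrices, Schur's test and the Blaschke contraction. -/

section Gram

variable {E : Type*} [NormedAddCommGroup E] [InnerProductSpace ℂ E]

theorem norm_sum_smul_sq {ι : Type*} (s : Finset ι) (a : ι → ℂ) (v : ι → E) :
    ((‖∑ i ∈ s, a i • v i‖ ^ 2 : ℝ) : ℂ)
      = ∑ i ∈ s, ∑ j ∈ s, starRingEnd ℂ (a i) * a j * inner ℂ (v i) (v j) := by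
  have : ((‖∑ i ∈ s, a i • v i‖ ^ 2 : ℝ) : ℂ)
      = inner ℂ (∑ i ∈ s, a i • v i) (∑ i ∈ s, a i • v i) := by
    rw [inner_self_eq_norm_sq_to_K]; simp
  rw [this, sum_inner]
  refine Finset.sum_congr rfl fun i _ => ?_
  rw [inner_sum]
  refine Finset.sum_congr rfl fun j _ => ?_
  rw [inner_smul_left, inner_smul_right, mul_assoc]

theorem inner_ofReal_smul_smul (a b : ℝ) (x y : E) :
    (inner ℂ ((a : ℂ) • x) ((b : ℂ) • y) : ℂ) = ((a * b : ℝ) : ℂ) * inner ℂ x y := by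
  rw [inner_smul_left, inner_smul_right, Complex.conj_ofReal]
  push_cast; ring

/-- Bessel's inequality for orthogonal vectors of norm at most one. -/
theorem norm_sum_smul_sq_le_of_orthogonal {ι : Type*} {s : Finset ι} {x : ι → E}
    (hx : ∀ i ∈ s, ‖x i‖ ≤ 1) (hxx : ∀ i ∈ s, ∀ j ∈ s, i ≠ j → (inner ℂ (x i) (x j) : ℂ) = 0)
    (c : ι → ℂ) : ‖∑ i ∈ s, c i • x i‖ ^ 2 ≤ ∑ i ∈ s, ‖c i‖ ^ 2 := by
  have h : ((‖∑ i ∈ s, c i • x i‖ ^ 2 : ℝ) : ℂ)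
      = ((∑ i ∈ s, ‖c i‖ ^ 2 * ‖x i‖ ^ 2 : ℝ) : ℂ) := by
    rw [norm_sum_smul_sq]
    push_cast
    refine Finset.sum_congr rfl fun i hi => ?_
    rw [Finset.sum_eq_single_of_mem i hi, inner_self_eq_norm_sq_to_K, mul_comm (starRingEnd ℂ _),
      Complex.mul_conj, Complex.normSq_eq_norm_sq]
    · push_cast; rfl
    · intro j hj hji
      rw [hxx i hi j hj hji.symm, mul_zero]
  rw [Complex.ofReal_injective h]
  exact Finset.sum_le_sum fun i hi =>
    mul_le_of_le_one_right (by positivity) (pow_le_one₀ (norm_nonneg _) (hx i hi))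

/-- Schur's test for families with geometrically decaying Gram matrix. -/
theorem norm_sum_smul_sq_le {g : ℕ → E} {σ C : ℝ} (h0 : 0 ≤ σ) (h1 : σ < 1) (hC : 0 ≤ C)
    (hg : ∀ i j, ‖(inner ℂ (g i) (g j) : ℂ)‖ ≤ C * σ ^ Nat.dist i j) (s : Finset ℕ) (c : ℕ → ℂ) :
    ‖∑ i ∈ s, c i • g i‖ ^ 2 ≤ C * (2 / (1 - σ)) * ∑ i ∈ s, ‖c i‖ ^ 2 := by
  have hrow : ∀ i, ∑ j ∈ s, C * σ ^ Nat.dist i j * ‖c i‖ ^ 2 ≤ C * (2 / (1 - σ)) * ‖c i‖ ^ 2 := by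
    intro i
    rw [← Finset.sum_mul, ← Finset.mul_sum]
    refine mul_le_mul_of_nonneg_right (mul_le_mul_of_nonneg_left ?_ hC) (by positivity)
    simp_rw [Nat.dist_comm i]
    exact sum_pow_dist_le h0 h1 s i
  calc ‖∑ i ∈ s, c i • g i‖ ^ 2
      = ‖((‖∑ i ∈ s, c i • g i‖ ^ 2 : ℝ) : ℂ)‖ := by
        rw [Complex.norm_real, Real.norm_of_nonneg (by positivity)]
    _ ≤ ∑ i ∈ s, ∑ j ∈ s, ‖starRingEnd ℂ (c i) * c j * inner ℂ (g i) (g j)‖ := by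
        rw [norm_sum_smul_sq]
        exact (norm_sum_le _ _).trans (Finset.sum_le_sum fun i _ => norm_sum_le _ _)
    -- The inequality `2 |cᵢ cⱼ| ≤ |cᵢ|² + |cⱼ|²` splits the form into two halves, equal by symmetry
    -- of the distance.
    _ ≤ ∑ i ∈ s, ∑ j ∈ s, (C * σ ^ Nat.dist i j * ‖c i‖ ^ 2 / 2
          + C * σ ^ Nat.dist j i * ‖c j‖ ^ 2 / 2) := by
        refine Finset.sum_le_sum fun i _ => Finset.sum_le_sum fun j _ => ?_
        rw [norm_mul, norm_mul, RCLike.norm_conj, Nat.dist_comm j i]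
        have hp : 0 ≤ C * σ ^ Nat.dist i j := by positivity
        calc _ ≤ ‖c i‖ * ‖c j‖ * (C * σ ^ Nat.dist i j) :=
              mul_le_mul_of_nonneg_left (hg i j) (by positivity)
          _ ≤ ((‖c i‖ ^ 2 + ‖c j‖ ^ 2) / 2) * (C * σ ^ Nat.dist i j) :=
              mul_le_mul_of_nonneg_right (by nlinarith [sq_nonneg (‖c i‖ - ‖c j‖)]) hp
          _ = _ := by ring
    _ = ∑ i ∈ s, ∑ j ∈ s, C * σ ^ Nat.dist i j * ‖c i‖ ^ 2 := by
        simp_rw [Finset.sum_add_distrib]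
        rw [Finset.sum_comm (f := fun i j => C * σ ^ Nat.dist j i * ‖c j‖ ^ 2 / 2),
          ← Finset.sum_add_distrib]
        refine Finset.sum_congr rfl fun i _ => ?_
        rw [← Finset.sum_add_distrib]
        exact Finset.sum_congr rfl fun j _ => add_halves _
    _ ≤ ∑ i ∈ s, C * (2 / (1 - σ)) * ‖c i‖ ^ 2 := Finset.sum_le_sum fun i _ => hrow i
    _ = _ := by rw [Finset.mul_sum]

/-- A synthesis bound dualises to a Bessel bound: the sum `S` equals `⟨y, x⟩` for `y = ∑ ⟨gᵢ, x⟩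
gᵢ`, and `‖y‖² ≤ B S`. -/
theorem sum_norm_inner_sq_le {g : ℕ → E} (s : Finset ℕ) {B : ℝ} (hB : 0 ≤ B)
    (hg : ∀ c : ℕ → ℂ, ‖∑ i ∈ s, c i • g i‖ ^ 2 ≤ B * ∑ i ∈ s, ‖c i‖ ^ 2) (x : E) :
    ∑ i ∈ s, ‖(inner ℂ (g i) x : ℂ)‖ ^ 2 ≤ B * ‖x‖ ^ 2 := by
  set S := ∑ i ∈ s, ‖(inner ℂ (g i) x : ℂ)‖ ^ 2 with hS
  have hS0 : 0 ≤ S := Finset.sum_nonneg fun _ _ => by positivity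
  set y := ∑ i ∈ s, (inner ℂ (g i) x : ℂ) • g i with hy
  have h1 : ‖y‖ ^ 2 ≤ B * S := hg _
  have h2 : (S : ℂ) = inner ℂ y x := by
    rw [hy, sum_inner, hS]
    push_cast
    refine Finset.sum_congr rfl fun i _ => ?_
    rw [inner_smul_left, mul_comm, Complex.mul_conj, Complex.normSq_eq_norm_sq]
    push_cast; rfl
  have h3 : S ≤ ‖y‖ * ‖x‖ := by
    have := norm_inner_le_norm (𝕜 := ℂ) y x
    rwa [← h2, Complex.norm_real, Real.norm_of_nonneg hS0] at this
  have h4 : S ^ 2 ≤ B * S * ‖x‖ ^ 2 := by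
    calc S ^ 2 ≤ (‖y‖ * ‖x‖) ^ 2 := pow_le_pow_left₀ hS0 h3 2
      _ = ‖y‖ ^ 2 * ‖x‖ ^ 2 := mul_pow _ _ _
      _ ≤ _ := mul_le_mul_of_nonneg_right h1 (by positivity)
  rcases hS0.eq_or_lt with h | h
  · rw [← h]; positivity
  · nlinarith

variable {w : ℕ → ℝ} {v : ℕ → E}

/-- Multiplying the coefficients by a Blaschke factor does not increase the norm. -/
theorem norm_sum_blaschke_le (hw : ∀ n, 0 < w n)
    (hv : ∀ i j, inner ℂ (v i) (v j) = ((1 / (w i + w j) : ℝ) : ℂ)) (s : Finset ℕ) (a : ℕ → ℂ)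
    {b : ℝ} (hb : 0 < b) :
    ‖∑ i ∈ s, (a i * (((w i - b) / (w i + b) : ℝ) : ℂ)) • v i‖ ≤ ‖∑ i ∈ s, a i • v i‖ := by
  -- The Gram kernel times one minus the product of the two Blaschke values is the rank-one positive
  -- kernel `2b / ((wᵢ + b)(wⱼ + b))`, so the defect is a square.
  have key : ((‖∑ i ∈ s, a i • v i‖ ^ 2
      - ‖∑ i ∈ s, (a i * (((w i - b) / (w i + b) : ℝ) : ℂ)) • v i‖ ^ 2 : ℝ) : ℂ)
      = ((2 * b * ‖∑ i ∈ s, a i * ((1 / (w i + b) : ℝ) : ℂ)‖ ^ 2 : ℝ) : ℂ) := by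
    have h3 : ((‖∑ i ∈ s, a i * ((1 / (w i + b) : ℝ) : ℂ)‖ ^ 2 : ℝ) : ℂ)
        = ∑ i ∈ s, ∑ j ∈ s, starRingEnd ℂ (a i) * a j
          * ((1 / ((w i + b) * (w j + b)) : ℝ) : ℂ) := by
      rw [← Complex.normSq_eq_norm_sq, ← Complex.mul_conj, mul_comm, map_sum, Finset.sum_mul_sum]
      refine Finset.sum_congr rfl fun i _ => Finset.sum_congr rfl fun j _ => ?_
      rw [map_mul, Complex.conj_ofReal]
      push_cast
      simp only [one_div, mul_inv]
      ring
    rw [Complex.ofReal_sub, Complex.ofReal_mul, norm_sum_smul_sq, norm_sum_smul_sq, h3,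
      ← Finset.sum_sub_distrib, Finset.mul_sum]
    refine Finset.sum_congr rfl fun i _ => ?_
    rw [← Finset.sum_sub_distrib, Finset.mul_sum]
    refine Finset.sum_congr rfl fun j _ => ?_
    have hi := hw i
    have hj := hw j
    have hid : 1 / (w i + w j) - (w i - b) / (w i + b) * ((w j - b) / (w j + b)) * (1 / (w i + w j))
        = 2 * b * (1 / ((w i + b) * (w j + b))) := by
      field_simp; ring
    have hid' := congrArg (fun x : ℝ => (x : ℂ)) hid
    simp only [Complex.ofReal_sub, Complex.ofReal_mul _ (1 / (w i + w j)),
      Complex.ofReal_mul ((w i - b) / (w i + b)),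
      Complex.ofReal_mul (2 * b)] at hid'
    rw [hv, map_mul, Complex.conj_ofReal]
    linear_combination (starRingEnd ℂ (a i) * a j) * hid'
  have key' := Complex.ofReal_injective key
  refine le_of_sq_le_sq ?_ (norm_nonneg _)
  have : 0 ≤ 2 * b * ‖∑ i ∈ s, a i * ((1 / (w i + b) : ℝ) : ℂ)‖ ^ 2 := by positivity
  linarith

theorem norm_sum_prod_blaschke_le (hw : ∀ n, 0 < w n)
    (hv : ∀ i j, inner ℂ (v i) (v j) = ((1 / (w i + w j) : ℝ) : ℂ)) (s u : Finset ℕ) (a : ℕ → ℂ) :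
    ‖∑ i ∈ s, (a i * ((∏ k ∈ u, (w i - w k) / (w i + w k) : ℝ) : ℂ)) • v i‖
      ≤ ‖∑ i ∈ s, a i • v i‖ := by
  classical
  induction u using Finset.induction_on with
  | empty => simp
  | insert k u hk ih =>
    refine le_trans (le_of_eq ?_) ((norm_sum_blaschke_le hw hv s
      (fun i => a i * ((∏ k ∈ u, (w i - w k) / (w i + w k) : ℝ) : ℂ)) (hw k)).trans ih)
    congr 1
    refine Finset.sum_congr rfl fun i _ => ?_
    rw [Finset.prod_insert hk]
    push_cast
    congr 1
    ring

/-- The Müntz-type bound for the coefficients of a lacunary sum. -/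
theorem norm_coeff_le {ρ : ℝ} (hρ : 0 ≤ ρ) (hρ1 : ρ < 1) (hw : ∀ n, 0 < w n)
    (h : ∀ n, w n ≤ ρ * w (n + 1))
    (hv : ∀ i j, inner ℂ (v i) (v j) = ((1 / (w i + w j) : ℝ) : ℂ)) {s : Finset ℕ} (a : ℕ → ℂ)
    {n : ℕ} (hn : n ∈ s) :
    ‖a n‖ ≤ Real.exp (4 / (1 - ρ) ^ 2) * √(2 * w n) * ‖∑ i ∈ s, a i • v i‖ := by
  classical
  -- The product over `s.erase n` vanishes at every other node of `s`, leaving only the `n`-th term.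
  have h1 := norm_sum_prod_blaschke_le hw hv s (s.erase n) a
  rw [Finset.sum_eq_single_of_mem n hn] at h1
  swap
  · intro i hi hin
    rw [Finset.prod_eq_zero (Finset.mem_erase.2 ⟨hin, hi⟩) (by simp)]
    simp
  have h2 := exp_neg_le_prod_blaschke hρ hρ1 hw h (Finset.notMem_erase n s)
  set P := ∏ k ∈ s.erase n, (w n - w k) / (w n + w k)
  have hwn := hw n
  have hvn : ‖v n‖ = (√(2 * w n))⁻¹ := by
    have h3 : ((‖v n‖ ^ 2 : ℝ) : ℂ) = ((1 / (w n + w n) : ℝ) : ℂ) := by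
      rw [← hv, inner_self_eq_norm_sq_to_K]; simp
    have h4 := Complex.ofReal_injective h3
    rw [← Real.sqrt_inv, eq_comm, Real.sqrt_eq_iff_eq_sq (by positivity) (norm_nonneg _), h4,
      two_mul, one_div]
  rw [norm_smul, norm_mul, Complex.norm_real, hvn, Real.norm_eq_abs] at h1
  have hsq : 0 < √(2 * w n) := Real.sqrt_pos.2 (by positivity)
  have h5 : ‖a n‖ * Real.exp (-(4 / (1 - ρ) ^ 2)) * (√(2 * w n))⁻¹ ≤ ‖∑ i ∈ s, a i • v i‖ := by
    refine le_trans ?_ h1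
    gcongr
  rw [Real.exp_neg, ← div_eq_mul_inv, ← div_eq_mul_inv, div_le_iff₀ hsq,
    div_le_iff₀ (Real.exp_pos _)] at h5
  linarith

end Gram

/-! ### Pointwise estimates for lacunary sums of powers. -/

section Estimates

variable {l : ℕ → ℝ} {ρ : ℝ}

theorem sqrt_pow_eq {x : ℝ} (hx : 0 ≤ x) (n : ℕ) : √(x ^ n) = √x ^ n := by
  rw [Real.sqrt_eq_iff_eq_sq (by positivity) (by positivity), ← pow_mul, mul_comm, pow_mul,
    Real.sq_sqrt hx]

theorem exists_le_of_lacunary (hρ : 0 < ρ) (hρ1 : ρ < 1) (hl : ∀ n, 0 < l n)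
    (h : ∀ n, l n ≤ ρ * l (n + 1)) (A : ℝ) : ∃ n, A ≤ l n := by
  rcases le_or_gt A 0 with hA | hA
  · exact ⟨0, hA.trans (hl 0).le⟩
  · obtain ⟨n, hn⟩ := exists_pow_lt_of_lt_one (div_pos (hl 0) hA) hρ1
    refine ⟨n, ?_⟩
    have h1 := le_pow_mul_of_lacunary hρ.le h 0 n
    rw [zero_add] at h1
    rw [lt_div_iff₀ hA] at hn
    have hp := pow_pos hρ n
    exact (le_of_mul_le_mul_left (hn.le.trans h1) hp)

theorem rpow_le_exp_neg {t x : ℝ} (ht : 0 ≤ t) (hx : 0 ≤ x) :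
    t ^ x ≤ Real.exp (-(x * (1 - t))) := by
  calc t ^ x ≤ Real.exp (t - 1) ^ x :=
        Real.rpow_le_rpow ht (by linarith [Real.add_one_le_exp (t - 1)]) hx
    _ = _ := by rw [← Real.exp_mul]; congr 1; ring

theorem sum_sqrt_mul_rpow_le (hρ : 0 < ρ) (hρ1 : ρ < 1) (hl : ∀ n, 0 < l n)
    (h : ∀ n, l n ≤ ρ * l (n + 1)) {t : ℝ} (ht : t ∈ Ico (0 : ℝ) 1) (s : Finset ℕ) :
    ∑ n ∈ s, √(l n) * t ^ l n ≤ (√ρ)⁻¹ * (2 / (1 - √ρ)) / √(1 - t) := by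
  classical
  have hy : 0 < 1 - t := by linarith [ht.2]
  have hσ : 0 < √ρ := Real.sqrt_pos.2 hρ
  have hσ1 : √ρ < 1 := by rw [Real.sqrt_lt' one_pos]; simpa using hρ1
  have hex := exists_le_of_lacunary hρ hρ1 hl h (1 / (1 - t))
  -- `m` is the first index with `l m ≥ 1 / (1 - t)`; the terms decay geometrically on both sides of
  -- it.
  set m := Nat.find hex with hm
  have hterm : ∀ n, √(l n) * t ^ l n * √(1 - t) ≤ (√ρ)⁻¹ * √ρ ^ Nat.dist n m := by
    intro n
    set x := l n * (1 - t) with hx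
    have hx0 : 0 < x := mul_pos (hl n) hy
    have hsx : 0 < √x := Real.sqrt_pos.2 hx0
    have h1 : √(l n) * t ^ l n * √(1 - t) ≤ √x * Real.exp (-x) := by
      rw [hx, Real.sqrt_mul (hl n).le, mul_right_comm]
      exact mul_le_mul_of_nonneg_left (rpow_le_exp_neg ht.1 (hl n).le) (by positivity)
    refine h1.trans ?_
    rcases le_or_gt m n with hmn | hmn
    · have h2 : 1 / (1 - t) ≤ l m := Nat.find_spec hex
      rw [div_le_iff₀ hy] at h2
      have h3 := le_pow_dist_mul_of_lacunary hρ.le h hmn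
      have h4 : 1 ≤ ρ ^ Nat.dist n m * x := by
        rw [hx, ← mul_assoc, Nat.dist_comm]
        exact h2.trans (mul_le_mul_of_nonneg_right h3 hy.le)
      have h5 : 1 ≤ √ρ ^ Nat.dist n m * √x := by
        rw [← Real.sqrt_one, ← sqrt_pow_eq hρ.le, ← Real.sqrt_mul (by positivity)]
        exact Real.sqrt_le_sqrt h4
      have h6 : x * Real.exp (-x) ≤ 1 := by
        rw [Real.exp_neg, ← div_eq_mul_inv, div_le_one (Real.exp_pos _)]
        linarith [Real.add_one_le_exp x]
      calc √x * Real.exp (-x) ≤ (√ρ ^ Nat.dist n m * √x) * (√x * Real.exp (-x)) :=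
            le_mul_of_one_le_left (by positivity) h5
        _ = √ρ ^ Nat.dist n m * (√x * √x * Real.exp (-x)) := by ring
        _ = √ρ ^ Nat.dist n m * (x * Real.exp (-x)) := by rw [Real.mul_self_sqrt hx0.le]
        _ ≤ √ρ ^ Nat.dist n m * 1 := mul_le_mul_of_nonneg_left h6 (by positivity)
        _ ≤ (√ρ)⁻¹ * √ρ ^ Nat.dist n m := by
          rw [mul_comm]
          exact mul_le_mul_of_nonneg_right ((one_le_inv₀ hσ).2 hσ1.le) (by positivity)
    -- Below `m` the comparison is with `m - 1`, where `l < 1 / (1 - t)`; this shift by one costs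
    -- the factor `(√ρ)⁻¹`.
    · obtain ⟨k, hk⟩ : ∃ k, m = k + 1 := ⟨m - 1, by omega⟩
      have h2 : ¬ 1 / (1 - t) ≤ l k := Nat.find_min hex (by omega)
      rw [not_le, lt_div_iff₀ hy] at h2
      have h3 := le_pow_dist_mul_of_lacunary hρ.le h (show n ≤ k by omega)
      have h4 : x ≤ ρ ^ Nat.dist n k := by
        calc x ≤ ρ ^ Nat.dist n k * l k * (1 - t) := mul_le_mul_of_nonneg_right h3 hy.le
          _ = ρ ^ Nat.dist n k * (l k * (1 - t)) := by ring
          _ ≤ ρ ^ Nat.dist n k * 1 := mul_le_mul_of_nonneg_left h2.le (by positivity)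
          _ = _ := mul_one _
      have h5 : √x ≤ √ρ ^ Nat.dist n k := by
        rw [← sqrt_pow_eq hρ.le]
        exact Real.sqrt_le_sqrt h4
      have h6 : Nat.dist n m = Nat.dist n k + 1 := by simp only [Nat.dist]; omega
      rw [h6, pow_succ, mul_comm _ √ρ, inv_mul_cancel_left₀ hσ.ne']
      refine le_trans (mul_le_of_le_one_right hsx.le ?_) h5
      rw [Real.exp_le_one_iff]; linarith
  rw [le_div_iff₀ (Real.sqrt_pos.2 hy), Finset.sum_mul]
  refine (Finset.sum_le_sum fun n _ => hterm n).trans ?_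
  rw [← Finset.mul_sum]
  exact mul_le_mul_of_nonneg_left (sum_pow_dist_le hσ.le hσ1 s m) (by positivity)

theorem exp_neg_le_rpow {δ t x : ℝ} (hδ : 0 < δ) (ht : δ ≤ t) (ht1 : t ≤ 1) (hx : 0 ≤ x) :
    Real.exp (-(x * (1 - t) / δ)) ≤ t ^ x := by
  have ht0 : 0 < t := hδ.trans_le ht
  rw [Real.rpow_def_of_pos ht0, Real.exp_le_exp]
  have h1 := Real.one_sub_inv_le_log_of_pos ht0
  have h2 : -((1 - t) / δ) ≤ 1 - t⁻¹ := by
    have : (1 - t) / t ≤ (1 - t) / δ := div_le_div_of_nonneg_left (by linarith) hδ ht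
    have h3 : (1 - t) / t = t⁻¹ - 1 := by field_simp
    linarith
  calc -(x * (1 - t) / δ) = -((1 - t) / δ) * x := by ring
    _ ≤ Real.log t * x := mul_le_mul_of_nonneg_right (h2.trans h1) hx

theorem exists_le_mul_rpow (hρ : 0 < ρ) (hρ1 : ρ < 1) (hl : ∀ n, 0 < l n)
    (h : ∀ n, l n ≤ ρ * l (n + 1)) {R : ℝ} (hR : ∀ n, l (n + 1) ≤ R * l n)
    {δ : ℝ} (hδ : 0 < δ) : ∃ c, 0 < c ∧ ∀ t ∈ Ico δ 1, ∃ n, c * (1 / (1 - t)) ≤ l n * t ^ (2 * l n) := by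
  classical
  have hR0 : 0 < R := by
    have := (hl 1).trans_le (hR 0)
    exact pos_of_mul_pos_left this (hl 0).le
  -- The two constants serve two cases: either `l 0` already exceeds `1 / (1 - t)`, or some `l k < 1
  -- / (1 - t) ≤ l (k + 1) ≤ R * l k`.
  refine ⟨min (δ ^ (2 * l 0)) (Real.exp (-(2 / δ)) / R), lt_min (by positivity) (by positivity), ?_⟩
  intro t ht
  have ht0 : 0 < t := hδ.trans_le ht.1
  have hy : 0 < 1 - t := by linarith [ht.2]
  have hex := exists_le_of_lacunary hρ hρ1 hl h (1 / (1 - t))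
  have hs : 1 / (1 - t) ≤ l (Nat.find hex) := Nat.find_spec hex
  rcases hm : Nat.find hex with _ | k
  · refine ⟨0, ?_⟩
    rw [hm] at hs
    calc _ ≤ δ ^ (2 * l 0) * (1 / (1 - t)) :=
          mul_le_mul_of_nonneg_right (min_le_left _ _) (by positivity)
      _ ≤ t ^ (2 * l 0) * l 0 := by
          have := hl 0
          exact mul_le_mul (Real.rpow_le_rpow hδ.le ht.1 (by positivity)) hs (by positivity)
            (by positivity)
      _ = _ := mul_comm _ _
  · refine ⟨k, ?_⟩
    rw [hm] at hs
    have h2 : ¬ 1 / (1 - t) ≤ l k := Nat.find_min hex (by omega)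
    rw [not_le, lt_div_iff₀ hy] at h2
    have hk := hl k
    have h3 : Real.exp (-(2 / δ)) ≤ t ^ (2 * l k) := by
      refine le_trans ?_ (exp_neg_le_rpow hδ ht.1 ht.2.le (by positivity))
      rw [Real.exp_le_exp, neg_le_neg_iff]
      gcongr
      linarith
    calc _ ≤ Real.exp (-(2 / δ)) / R * (1 / (1 - t)) :=
          mul_le_mul_of_nonneg_right (min_le_right _ _) (by positivity)
      _ ≤ Real.exp (-(2 / δ)) / R * (R * l k) :=
          mul_le_mul_of_nonneg_left (hs.trans (hR k)) (by positivity)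
      _ = Real.exp (-(2 / δ)) * l k := by field_simp
      _ ≤ t ^ (2 * l k) * l k := mul_le_mul_of_nonneg_right h3 hk.le
      _ = _ := mul_comm _ _

theorem IsQuasiGeometric.exists_lacunary {Λ : ℕ → ℝ} (hΛ : IsQuasiGeometric Λ) :
    ∃ ρ : ℝ, 0 < ρ ∧ ρ < 1 ∧ (∀ n, Λ n ≤ ρ * Λ (n + 1)) ∧
      (∀ n, Λ n + 1 / 2 ≤ ρ * (Λ (n + 1) + 1 / 2)) ∧ ∃ R, ∀ n, Λ (n + 1) ≤ R * Λ n := by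
  obtain ⟨h0, r, R, hr, hrR⟩ := hΛ
  have hΛr : ∀ n, r * Λ n ≤ Λ (n + 1) := fun n => (le_div_iff₀ (h0 n)).1 (hrR n).1
  have hmono : ∀ n, Λ 0 ≤ Λ n := by
    intro n
    induction n with
    | zero => exact le_rfl
    | succ n ih => nlinarith [hΛr n, h0 n]
  have hp := h0 0
  have hden : 0 < r * Λ 0 + 1 / 2 := by positivity
  -- One `ρ` for both `Λ` and its shift: `(x + 1/2) / (r x + 1/2)` decreases in `x`, so `x = Λ 0` is
  -- the worst case, and it is at least `1 / r`.
  refine ⟨(Λ 0 + 1 / 2) / (r * Λ 0 + 1 / 2), by positivity, ?_, ?_, ?_, R,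
    fun n => (div_le_iff₀ (h0 n)).1 (hrR n).2⟩
  · rw [div_lt_one hden]; nlinarith
  · intro n
    rw [div_mul_eq_mul_div, le_div_iff₀ hden]
    nlinarith [mul_le_mul_of_nonneg_left (hΛr n) hp.le, hΛr n, h0 n]
  · intro n
    rw [div_mul_eq_mul_div, le_div_iff₀ hden]
    nlinarith [mul_le_mul_of_nonneg_left (hΛr n) hp.le, hΛr n, h0 n,
      mul_nonneg (sub_nonneg.2 hr.le) (sub_nonneg.2 (hmono n))]

end Estimates

/-! ### Biorthogonal functionals by Hahn–Banach. -/

section CoefficientFunctionals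

variable {E : Type*} [NormedAddCommGroup E] [NormedSpace ℂ E]

/-- A uniformly minimal family has a bounded biorthogonal family of functionals. -/
theorem exists_biorthogonal_functionals {v : ℕ → E} {K : ℕ → ℝ} (hK : ∀ n, 0 ≤ K n)
    (h : ∀ (s : Finset ℕ) (a : ℕ → ℂ), ∀ n ∈ s, ‖a n‖ ≤ K n * ‖∑ i ∈ s, a i • v i‖) :
    ∃ φ : ℕ → StrongDual ℂ E, (∀ n, φ n (v n) = 1) ∧ (∀ n m, n ≠ m → φ n (v m) = 0) ∧
      ∀ n f, ‖φ n f‖ ≤ K n * ‖f‖ := by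
  classical
  have hli : LinearIndependent ℂ v := by
    rw [linearIndependent_iff']
    intro s a hs i hi
    have := h s a i hi
    rw [hs, norm_zero, mul_zero] at this
    exact norm_le_zero_iff.1 this
  have hψ : ∀ n, ∃ φ : StrongDual ℂ E, (∀ m, φ (v m) = if n = m then 1 else 0) ∧
      ∀ f, ‖φ f‖ ≤ K n * ‖f‖ := by
    intro n
    set p := Submodule.span ℂ (range v)
    set L : p →ₗ[ℂ] ℂ := Finsupp.lapply n ∘ₗ hli.repr with hL
    have hb : ∀ f : p, ‖L f‖ ≤ K n * ‖f‖ := by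
      -- An index outside the support of the expansion has coefficient zero, so the hypothesis is
      -- needed only on the support.
      intro f
      by_cases hn : n ∈ (hli.repr f).support
      · have h1 := h (hli.repr f).support (hli.repr f) n hn
        have h2 : ∑ i ∈ (hli.repr f).support, hli.repr f i • v i = f := by
          have := hli.linearCombination_repr f
          rwa [Finsupp.linearCombination_apply] at this
        rw [h2] at h1
        exact h1
      · have : L f = 0 := by simpa [hL] using hn
        rw [this, norm_zero]
        exact mul_nonneg (hK n) (norm_nonneg _)
    obtain ⟨φ, hφ, hφn⟩ := exists_extension_norm_eq p (L.mkContinuous (K n) hb)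
    refine ⟨φ, fun m => ?_, fun f => ?_⟩
    · have hm : v m ∈ p := Submodule.subset_span ⟨m, rfl⟩
      rw [hφ ⟨v m, hm⟩]
      have : hli.repr ⟨v m, hm⟩ = Finsupp.single m 1 := hli.repr_eq_single m _ rfl
      simp [hL, this, Finsupp.single_apply, eq_comm]
    · refine (φ.le_opNorm f).trans (mul_le_mul_of_nonneg_right ?_ (norm_nonneg _))
      rw [hφn]
      exact LinearMap.mkContinuous_norm_le _ (hK n) _
  choose φ h1 h2 using hψ
  exact ⟨φ, fun n => by simp [h1], fun n m hnm => by simp [h1, hnm], h2⟩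

end CoefficientFunctionals

/-! ### Pointwise values and point evaluations on the Müntz space. -/

section Muntz

open Filter Topology

theorem norm_rpow_le_one {t x : ℝ} (ht : t ∈ Icc (0 : ℝ) 1) (hx : 0 ≤ x) :
    ‖((t ^ x : ℝ) : ℂ)‖ ≤ 1 := by
  rw [Complex.norm_real, Real.norm_of_nonneg (Real.rpow_nonneg ht.1 _)]
  exact Real.rpow_le_one ht.1 ht.2 hx

theorem memLp_rpow {x : ℝ} (hx : 0 < x) :
    MemLp (fun t : ℝ => ((t ^ x : ℝ) : ℂ)) 2 ((volume : Measure ℝ).restrict (Icc 0 1)) := by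
  refine MemLp.of_bound ?_ 1 ?_
  · exact (Complex.continuous_ofReal.comp (Real.continuous_rpow_const hx.le)).aestronglyMeasurable
  · filter_upwards [ae_restrict_mem measurableSet_Icc] with t ht
    exact norm_rpow_le_one ht hx.le

/-- The monomial `t ^ x` as an element of `L²([0,1])`. -/
def rpowL2 {x : ℝ} (hx : 0 < x) : LebesgueL2 := (memLp_rpow hx).toLp _

theorem coeFn_rpowL2 {x : ℝ} (hx : 0 < x) :
    rpowL2 hx =ᵐ[(volume : Measure ℝ).restrict (Icc 0 1)] fun t : ℝ => ((t ^ x : ℝ) : ℂ) :=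
  (memLp_rpow hx).coeFn_toLp

theorem inner_rpowL2 {x y : ℝ} (hx : 0 < x) (hy : 0 < y) :
    inner ℂ (rpowL2 hx) (rpowL2 hy) = ((1 / (x + 1 / 2 + (y + 1 / 2)) : ℝ) : ℂ) := by
  rw [L2.inner_def]
  have h1 : ∫ t in Icc (0 : ℝ) 1, inner ℂ (rpowL2 hx t) (rpowL2 hy t)
      = ∫ t in Icc (0 : ℝ) 1, ((t ^ (x + y) : ℝ) : ℂ) := by
    refine integral_congr_ae ?_
    filter_upwards [coeFn_rpowL2 hx, coeFn_rpowL2 hy, ae_restrict_mem measurableSet_Icc]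
      with t h1 h2 ht
    rw [h1, h2, RCLike.inner_apply, Complex.conj_ofReal, ← Complex.ofReal_mul, mul_comm,
      ← Real.rpow_add_of_nonneg ht.1 hx.le hy.le]
  rw [h1, integral_complex_ofReal, integral_Icc_eq_integral_Ioc,
    ← intervalIntegral.integral_of_le zero_le_one, integral_rpow (Or.inl (by linarith)),
    Real.one_rpow, Real.zero_rpow (by linarith)]
  congr 1
  rw [sub_zero]; ring

/-- On `[0, b]` with `b < 1` the terms are dominated by their absolute values at `b`, which are
summable, so convergence is uniform there. -/
theorem continuousOn_of_hasSum_rpow {Λ : ℕ → ℝ} (hΛ : ∀ n, 0 < Λ n) {a : ℕ → ℂ} {g : ℝ → ℂ}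
    (h : ∀ t ∈ Ico (0 : ℝ) 1, HasSum (fun n => a n * ((t ^ Λ n : ℝ) : ℂ)) (g t)) :
    ContinuousOn g (Ico 0 1) := by
  intro t ht
  obtain ⟨b, htb, hb1⟩ := exists_between ht.2
  have hb0 : 0 ≤ b := ht.1.trans htb.le
  have hc : ContinuousOn (fun t : ℝ => ∑' n, a n * ((t ^ Λ n : ℝ) : ℂ)) (Icc 0 b) := by
    refine continuousOn_tsum (u := fun n => ‖a n * ((b ^ Λ n : ℝ) : ℂ)‖) (fun n => ?_)
      (h b ⟨hb0, hb1⟩).summable.norm fun n x hx => ?_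
    · exact (continuous_const.mul
        (Complex.continuous_ofReal.comp (Real.continuous_rpow_const (hΛ n).le))).continuousOn
    · rw [norm_mul, norm_mul, Complex.norm_real, Complex.norm_real,
        Real.norm_of_nonneg (Real.rpow_nonneg hx.1 _), Real.norm_of_nonneg (Real.rpow_nonneg hb0 _)]
      exact mul_le_mul_of_nonneg_left (Real.rpow_le_rpow hx.1 hx.2 (hΛ n).le) (norm_nonneg _)
  have hg : ContinuousOn g (Icc 0 b) :=
    hc.congr fun x hx => (h x ⟨hx.1, hx.2.trans_lt hb1⟩).tsum_eq.symm
  refine (hg t ⟨ht.1, htb.le⟩).mono_of_mem_nhdsWithin ?_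
  filter_upwards [self_mem_nhdsWithin, mem_nhdsWithin_of_mem_nhds (Iio_mem_nhds htb)] with x hx hxb
  exact ⟨hx.1, le_of_lt hxb⟩

theorem ae_Ico_of_ae_Icc {p : ℝ → Prop} (h : ∀ᵐ t ∂(volume : Measure ℝ).restrict (Icc 0 1), p t) :
    ∀ᵐ t ∂(volume : Measure ℝ).restrict (Ico 0 1), p t :=
  ae_restrict_of_ae_restrict_of_subset Ico_subset_Icc_self h

theorem ae_mem_Ico : ∀ᵐ t ∂(volume : Measure ℝ).restrict (Icc 0 1), t ∈ Ico (0 : ℝ) 1 := by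
  rw [← Measure.restrict_congr_set (Ico_ae_eq_Icc (μ := (volume : Measure ℝ)) (a := 0) (b := 1))]
  exact ae_restrict_mem measurableSet_Ico

/-- The pointwise values on `[0,1)` of an element of the Müntz space are unique. -/
theorem IsMuntzRepresentative.eqOn {Λ : ℕ → ℝ} (hΛ : ∀ n, 0 < Λ n) {f : muntzSpace Λ}
    {g g' : ℝ → ℂ} (hg : IsMuntzRepresentative Λ f g) (hg' : IsMuntzRepresentative Λ f g') :
    EqOn g g' (Ico 0 1) := by
  obtain ⟨h1, a, ha⟩ := hg
  obtain ⟨h1', a', ha'⟩ := hg'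
  -- Continuity upgrades Lebesgue-a.e. equality to equality everywhere, which is essential because
  -- `μ` may be singular.
  exact Measure.eqOn_Ico_of_ae_eq volume (ae_Ico_of_ae_Icc (h1.symm.trans h1'))
    (continuousOn_of_hasSum_rpow hΛ ha) (continuousOn_of_hasSum_rpow hΛ ha')

/-- The series `∑ φₙ(f) t ^ Λ n` on `[0,1)`, as a linear function of `f`. -/
def seriesEval (Λ : ℕ → ℝ) (φ : ℕ → StrongDual ℂ LebesgueL2)
    (hs : ∀ f, ∀ t ∈ Ico (0 : ℝ) 1, Summable fun n => φ n f * ((t ^ Λ n : ℝ) : ℂ)) :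
    LebesgueL2 →ₗ[ℂ] ℝ → ℂ where
  toFun f := indicator (Ico 0 1) fun t => ∑' n, φ n f * ((t ^ Λ n : ℝ) : ℂ)
  map_add' f g := by
    ext t
    by_cases ht : t ∈ Ico (0 : ℝ) 1
    · simp only [Pi.add_apply, indicator_of_mem ht, map_add, add_mul]
      exact (hs f t ht).tsum_add (hs g t ht)
    · simp [indicator_of_notMem ht]
  map_smul' c f := by
    ext t
    by_cases ht : t ∈ Ico (0 : ℝ) 1
    · simp only [Pi.smul_apply, indicator_of_mem ht, map_smul, smul_eq_mul, mul_assoc, tsum_mul_left,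
        RingHom.id_apply]
    · simp [indicator_of_notMem ht]

/-- Point evaluations on the Müntz space of a quasi-geometric sequence. -/
theorem exists_muntz_evaluation {Λ : ℕ → ℝ} (hΛ : IsQuasiGeometric Λ) :
    ∃ (e : muntzSpace Λ →ₗ[ℂ] ℝ → ℂ) (K : ℝ), 0 < K ∧ (∀ f, IsMuntzRepresentative Λ f (e f)) ∧
      ∀ f, ∀ t ∈ Ico (0 : ℝ) 1, ‖e f t‖ ≤ K / √(1 - t) * ‖f‖ := by
  obtain ⟨ρ, hρ, hρ1, hΛρ, hwρ, -⟩ := hΛ.exists_lacunary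
  have h0 := hΛ.1
  set w : ℕ → ℝ := fun n => Λ n + 1 / 2 with hw
  have hw0 : ∀ n, 0 < w n := fun n => by have := h0 n; positivity
  set v : ℕ → LebesgueL2 := fun n => rpowL2 (h0 n) with hv
  obtain ⟨φ, hφ1, hφ0, hφK⟩ := exists_biorthogonal_functionals (v := v)
    (K := fun n => Real.exp (4 / (1 - ρ) ^ 2) * √(2 * w n)) (fun n => by positivity)
    fun s a n hn => norm_coeff_le hρ.le hρ1 hw0 hwρ (fun i j => inner_rpowL2 (h0 i) (h0 j)) a hn
  -- Since `Λ 0 ≤ Λ n`, this gives `2 * w n = 2 * Λ n + 1 ≤ D * Λ n`.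
  set D := 2 + 1 / Λ 0 with hD
  have hD0 : 0 < D := by have := h0 0; positivity
  have hmono : ∀ n, Λ 0 ≤ Λ n := by
    intro n
    induction n with
    | zero => exact le_rfl
    | succ n ih => nlinarith [hΛρ n, h0 (n + 1)]
  have hwD : ∀ n, √(2 * w n) ≤ √D * √(Λ n) := by
    intro n
    rw [← Real.sqrt_mul hD0.le]
    refine Real.sqrt_le_sqrt ?_
    have h1 : 1 ≤ 1 / Λ 0 * Λ n := by
      rw [one_div_mul_eq_div, le_div_iff₀ (h0 0), one_mul]; exact hmono n
    simp only [hw, hD]; linarith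
  set C := Real.exp (4 / (1 - ρ) ^ 2) * √D with hC
  have hC0 : 0 < C := by positivity
  set K := C * ((√ρ)⁻¹ * (2 / (1 - √ρ))) with hK
  have hσ : 0 < √ρ := Real.sqrt_pos.2 hρ
  have hσ1 : √ρ < 1 := by rw [Real.sqrt_lt' one_pos]; simpa using hρ1
  have hσ2 : 0 < 1 - √ρ := by linarith
  have hK0 : 0 < K := by positivity
  have hsum : ∀ f, ∀ t ∈ Ico (0 : ℝ) 1, ∀ s : Finset ℕ,
      ∑ n ∈ s, ‖φ n f * ((t ^ Λ n : ℝ) : ℂ)‖ ≤ K / √(1 - t) * ‖f‖ := by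
    intro f t ht s
    calc ∑ n ∈ s, ‖φ n f * ((t ^ Λ n : ℝ) : ℂ)‖
        ≤ ∑ n ∈ s, C * ‖f‖ * (√(Λ n) * t ^ Λ n) := by
          refine Finset.sum_le_sum fun n _ => ?_
          have htn := Real.rpow_nonneg ht.1 (Λ n)
          rw [norm_mul, Complex.norm_real, Real.norm_of_nonneg htn]
          calc ‖φ n f‖ * t ^ Λ n
              ≤ (Real.exp (4 / (1 - ρ) ^ 2) * √(2 * w n) * ‖f‖) * t ^ Λ n :=
                mul_le_mul_of_nonneg_right (hφK n f) htn
            _ ≤ (Real.exp (4 / (1 - ρ) ^ 2) * (√D * √(Λ n)) * ‖f‖) * t ^ Λ n := by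
                gcongr; exact hwD n
            _ = _ := by rw [hC]; ring
      _ = C * ‖f‖ * ∑ n ∈ s, √(Λ n) * t ^ Λ n := by rw [Finset.mul_sum]
      _ ≤ C * ‖f‖ * ((√ρ)⁻¹ * (2 / (1 - √ρ)) / √(1 - t)) :=
          mul_le_mul_of_nonneg_left (sum_sqrt_mul_rpow_le hρ hρ1 h0 hΛρ ht s) (by positivity)
      _ = _ := by rw [hK]; ring
  have hs : ∀ f, ∀ t ∈ Ico (0 : ℝ) 1, Summable fun n => φ n f * ((t ^ Λ n : ℝ) : ℂ) :=
    fun f t ht => (summable_of_sum_le (fun n => norm_nonneg _) (hsum f t ht)).of_norm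
  set e := seriesEval Λ φ hs with he
  have heval : ∀ f, ∀ t ∈ Ico (0 : ℝ) 1, e f t = ∑' n, φ n f * ((t ^ Λ n : ℝ) : ℂ) :=
    fun f t ht => indicator_of_mem ht fun t => ∑' n, φ n f * ((t ^ Λ n : ℝ) : ℂ)
  have hbound : ∀ f, ∀ t ∈ Ico (0 : ℝ) 1, ‖e f t‖ ≤ K / √(1 - t) * ‖f‖ := by
    intro f t ht
    rw [heval f t ht]
    have hsn := (hs f t ht).norm
    exact (norm_tsum_le_tsum_norm hsn).trans (hsn.tsum_le_of_sum_le (hsum f t ht))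
  have hev : ∀ n, ∀ t ∈ Ico (0 : ℝ) 1, e (v n) t = ((t ^ Λ n : ℝ) : ℂ) := by
    intro n t ht
    rw [heval _ t ht, tsum_eq_single n, hφ1, one_mul]
    intro m hm
    rw [hφ0 m n hm, zero_mul]
  have hspan : ∀ f ∈ Submodule.span ℂ {f : LebesgueL2 | ∃ n,
      f =ᵐ[(volume : Measure ℝ).restrict (Icc 0 1)] fun t : ℝ => ((t ^ Λ n : ℝ) : ℂ)},
      f =ᵐ[(volume : Measure ℝ).restrict (Icc 0 1)] e f := by
    intro f hf
    induction hf using Submodule.span_induction with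
    | mem f hf =>
      obtain ⟨n, hn⟩ := hf
      have hfv : f = v n := Lp.ext (hn.trans (coeFn_rpowL2 (h0 n)).symm)
      rw [hfv] at hn ⊢
      filter_upwards [hn, ae_mem_Ico] with t h1 ht
      rw [h1, hev n t ht]
    | zero =>
      rw [map_zero]
      exact Lp.coeFn_zero _ _ _
    | add f g _ _ hf hg =>
      rw [map_add]
      exact (Lp.coeFn_add f g).trans (hf.add hg)
    | smul c f _ hf =>
      rw [map_smul]
      exact (Lp.coeFn_smul c f).trans (hf.const_smul c)
  -- The functionals, hence `e`, live on all of `L²`, but the series is shown to represent `f` only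
  -- on the closed span.
  refine ⟨e.domRestrict (muntzSpace Λ), K, hK0, fun f => ⟨?_, fun n => φ n f, fun t ht => ?_⟩,
    fun f t ht => hbound f t ht⟩
  -- For `u k → f` from the span, a subsequence converges a.e. to `f`, while the evaluation bound
  -- gives `e (u k) t → e f t` at each `t`; the limits agree.
  · obtain ⟨u, hu, hul⟩ := mem_closure_iff_seq_limit.1 f.2
    obtain ⟨ns, hns, hlim⟩ := (tendstoInMeasure_of_tendsto_Lp hul).exists_seq_tendsto_ae
    have hall := ae_all_iff.2 fun k => hspan (u k) (hu k)
    filter_upwards [hlim, hall, ae_mem_Ico] with t h1 h2 ht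
    have h3 : Tendsto (fun k => e (u (ns k)) t) atTop (𝓝 (e f t)) := by
      rw [tendsto_iff_norm_sub_tendsto_zero]
      have h4 : Tendsto (fun k => K / √(1 - t) * ‖u (ns k) - f‖) atTop (𝓝 0) := by
        have := (tendsto_iff_norm_sub_tendsto_zero.1 (hul.comp hns.tendsto_atTop)).const_mul
          (K / √(1 - t))
        simpa using this
      refine squeeze_zero (fun _ => norm_nonneg _) (fun k => ?_) h4
      have := hbound (u (ns k) - f) t ht
      rwa [map_sub] at this
    refine tendsto_nhds_unique h1 (h3.congr fun k => (h2 (ns k)).symm)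
  · rw [LinearMap.domRestrict_apply, heval _ t ht]
    exact (hs f t ht).hasSum

end Muntz

/-! ### The Carleson embedding: both Hilbert–Schmidt estimates. -/

section Carleson

theorem enorm_sq_eq_lintegral {α : Type*} [MeasurableSpace α] {μ : Measure α} {h : Lp ℂ 2 μ}
    {g : α → ℂ} (hg : h =ᵐ[μ] g) :
    ENNReal.ofReal (‖h‖ ^ 2) = ∫⁻ t, ENNReal.ofReal (‖g t‖ ^ 2) ∂μ := by
  have h1 := eLpNorm_nnreal_pow_eq_lintegral (μ := μ) (f := h) (p := 2) two_ne_zero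
  rw [ENNReal.ofReal_pow (norm_nonneg _), ofReal_norm, Lp.enorm_def]
  calc _ = ∫⁻ t, ‖h t‖ₑ ^ (2 : ℝ) ∂μ := by
        rw [← ENNReal.rpow_natCast]; exact h1
    _ = _ := by
        refine lintegral_congr_ae ?_
        filter_upwards [hg] with t ht
        rw [ht, ENNReal.ofReal_pow (norm_nonneg _), ofReal_norm, ← ENNReal.rpow_natCast]
        norm_num

variable {Λ : ℕ → ℝ} {μ : Measure ℝ}

theorem ae_mem_of_measure_compl (hμ : μ (Ico (0 : ℝ) 1)ᶜ = 0) : ∀ᵐ t ∂μ, t ∈ Ico (0 : ℝ) 1 := hμ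

theorem IsCarlesonEmbedding.ae_eq (hΛ : ∀ n, 0 < Λ n) (hμ : μ (Ico (0 : ℝ) 1)ᶜ = 0)
    {T : muntzSpace Λ →L[ℂ] Lp ℂ 2 μ} (hT : IsCarlesonEmbedding Λ μ T) {f : muntzSpace Λ}
    {g : ℝ → ℂ} (hg : IsMuntzRepresentative Λ f g) : T f =ᵐ[μ] g := by
  obtain ⟨g', hg', hTg⟩ := hT f
  filter_upwards [hTg, ae_mem_of_measure_compl hμ] with t h1 ht
  rw [h1, hg'.eqOn hΛ hg ht]

section Upper

variable {e : muntzSpace Λ →ₗ[ℂ] ℝ → ℂ} {K : ℝ}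

/-- Testing evaluation on `f = ∑ conj(xᵢ(t)) xᵢ` gives `f(t) = S` and `‖f‖² ≤ S`, hence `S ≤ K √S /
√(1 - t)`. -/
theorem sum_sq_norm_eval_le
    (heK : ∀ f, ∀ t ∈ Ico (0 : ℝ) 1, ‖e f t‖ ≤ K / √(1 - t) * ‖f‖) {N : ℕ}
    {x : ℕ → muntzSpace Λ} (hx : ∀ i < N, ‖x i‖ ≤ 1)
    (hxx : ∀ i < N, ∀ j < N, i ≠ j → inner ℂ (x i) (x j) = 0) {t : ℝ} (ht : t ∈ Ico (0 : ℝ) 1) :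
    ∑ i ∈ Finset.range N, ‖e (x i) t‖ ^ 2 ≤ K ^ 2 * (1 / (1 - t)) := by
  have hy : 0 < 1 - t := by linarith [ht.2]
  set S := ∑ i ∈ Finset.range N, ‖e (x i) t‖ ^ 2 with hS
  have hS0 : 0 ≤ S := Finset.sum_nonneg fun _ _ => by positivity
  set f := ∑ i ∈ Finset.range N, starRingEnd ℂ (e (x i) t) • x i with hf
  have h1 : e f t = (S : ℂ) := by
    rw [hf, map_sum, Finset.sum_apply, hS]
    push_cast
    refine Finset.sum_congr rfl fun i _ => ?_
    rw [map_smul, Pi.smul_apply, smul_eq_mul, mul_comm, Complex.mul_conj,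
      Complex.normSq_eq_norm_sq]
    push_cast; rfl
  have h2 : ‖f‖ ^ 2 ≤ S := by
    refine (norm_sum_smul_sq_le_of_orthogonal (s := Finset.range N)
      (fun i hi => hx i (Finset.mem_range.1 hi))
      (fun i hi j hj => hxx i (Finset.mem_range.1 hi) j (Finset.mem_range.1 hj))
      fun i => starRingEnd ℂ (e (x i) t)).trans (le_of_eq ?_)
    exact Finset.sum_congr rfl fun i _ => by rw [RCLike.norm_conj]
  have h4 := heK f t ht
  rw [h1, Complex.norm_real, Real.norm_of_nonneg hS0] at h4
  have h5 : S ^ 2 ≤ K ^ 2 * (1 / (1 - t)) * S := by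
    calc S ^ 2 ≤ (K / √(1 - t) * ‖f‖) ^ 2 := pow_le_pow_left₀ hS0 h4 2
      _ = K ^ 2 * (1 / (1 - t)) * ‖f‖ ^ 2 := by
        rw [mul_pow, div_pow, Real.sq_sqrt hy.le]; ring
      _ ≤ _ := mul_le_mul_of_nonneg_left h2 (by positivity)
  rcases hS0.eq_or_lt with h | h
  · rw [← h]; positivity
  · rw [pow_two] at h5
    exact le_of_mul_le_mul_right h5 h

theorem sum_approxNumber_sq_le (hΛ : ∀ n, 0 < Λ n) (he : ∀ f, IsMuntzRepresentative Λ f (e f))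
    (heK : ∀ f, ∀ t ∈ Ico (0 : ℝ) 1, ‖e f t‖ ≤ K / √(1 - t) * ‖f‖)
    (hμ : μ (Ico (0 : ℝ) 1)ᶜ = 0) {T : muntzSpace Λ →L[ℂ] Lp ℂ 2 μ}
    (hT : IsCarlesonEmbedding Λ μ T) (N : ℕ) :
    ENNReal.ofReal (∑ i ∈ Finset.range N, approxNumber T (i + 1) ^ (2 : ℝ))
      ≤ ENNReal.ofReal (4 * K ^ 2) * ∫⁻ t in Ico (0 : ℝ) 1, ENNReal.ofReal (1 / (1 - t)) ∂μ := by
  obtain ⟨x, hx, hxx, hxT⟩ := exists_orthogonal_approxNumber_le T N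
  have hae : ∀ i, T (x i) =ᵐ[μ] e (x i) := fun i => hT.ae_eq hΛ hμ (he _)
  have hmeas : ∀ i, AEMeasurable (fun t => ENNReal.ofReal (‖e (x i) t‖ ^ 2)) μ := fun i =>
    (((Lp.aestronglyMeasurable (T (x i))).congr (hae i)).norm.aemeasurable.pow_const
      2).ennreal_ofReal
  rw [Measure.restrict_eq_self_of_ae_mem (ae_mem_of_measure_compl hμ)]
  calc ENNReal.ofReal (∑ i ∈ Finset.range N, approxNumber T (i + 1) ^ (2 : ℝ))
      ≤ ENNReal.ofReal (4 * ∑ i ∈ Finset.range N, ‖T (x i)‖ ^ 2) := by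
        refine ENNReal.ofReal_le_ofReal ?_
        rw [Finset.mul_sum]
        refine Finset.sum_le_sum fun i hi => ?_
        rw [Real.rpow_two]
        calc _ ≤ (2 * ‖T (x i)‖) ^ 2 :=
              pow_le_pow_left₀ (approxNumber_nonneg _ _) (hxT i (Finset.mem_range.1 hi)) 2
          _ = _ := by ring
    _ = ENNReal.ofReal 4 * ∑ i ∈ Finset.range N, ∫⁻ t, ENNReal.ofReal (‖e (x i) t‖ ^ 2) ∂μ := by
        rw [ENNReal.ofReal_mul (by norm_num), ENNReal.ofReal_sum_of_nonneg fun _ _ => by positivity]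
        congr 1
        exact Finset.sum_congr rfl fun i _ => enorm_sq_eq_lintegral (hae i)
    _ = ENNReal.ofReal 4 * ∫⁻ t, ∑ i ∈ Finset.range N, ENNReal.ofReal (‖e (x i) t‖ ^ 2) ∂μ := by
        rw [lintegral_finsetSum' _ fun i _ => hmeas i]
    _ ≤ ENNReal.ofReal 4 * ∫⁻ t, ENNReal.ofReal (K ^ 2) * ENNReal.ofReal (1 / (1 - t)) ∂μ := by
        refine mul_le_mul_right (lintegral_mono_ae ?_) _
        filter_upwards [ae_mem_of_measure_compl hμ] with t ht
        rw [← ENNReal.ofReal_sum_of_nonneg fun _ _ => by positivity,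
          ← ENNReal.ofReal_mul (by positivity)]
        exact ENNReal.ofReal_le_ofReal (sum_sq_norm_eval_le heK hx hxx ht)
    _ = _ := by
        rw [lintegral_const_mul' _ _ ENNReal.ofReal_ne_top, ← mul_assoc,
          ← ENNReal.ofReal_mul (by norm_num)]

/-- The evaluation bound makes `K² ‖f‖² / (1 - t)` a `μ`-integrable majorant of `|f|²`. -/
theorem exists_carlesonEmbedding (hΛ : ∀ n, 0 < Λ n) (hK : 0 < K)
    (he : ∀ f, IsMuntzRepresentative Λ f (e f))
    (heK : ∀ f, ∀ t ∈ Ico (0 : ℝ) 1, ‖e f t‖ ≤ K / √(1 - t) * ‖f‖)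
    (hμ : μ (Ico (0 : ℝ) 1)ᶜ = 0)
    (hD : ∫⁻ t in Ico (0 : ℝ) 1, ENNReal.ofReal (1 / (1 - t)) ∂μ < ⊤) :
    ∃ T : muntzSpace Λ →L[ℂ] Lp ℂ 2 μ, IsCarlesonEmbedding Λ μ T := by
  have hres := Measure.restrict_eq_self_of_ae_mem (ae_mem_of_measure_compl hμ)
  rw [hres] at hD
  set D := ∫⁻ t, ENNReal.ofReal (1 / (1 - t)) ∂μ with hDdef
  have hmeas : ∀ f, AEStronglyMeasurable (e f) μ := by
    intro f
    obtain ⟨-, a, ha⟩ := he f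
    have := (continuousOn_of_hasSum_rpow hΛ ha).aestronglyMeasurable (μ := μ) measurableSet_Ico
    rwa [hres] at this
  have hle : ∀ f, ∫⁻ t, ENNReal.ofReal (‖e f t‖ ^ 2) ∂μ ≤ ENNReal.ofReal ((K * ‖f‖) ^ 2) * D := by
    intro f
    rw [hDdef, ← lintegral_const_mul' _ _ ENNReal.ofReal_ne_top]
    refine lintegral_mono_ae ?_
    filter_upwards [ae_mem_of_measure_compl hμ] with t ht
    have hy : 0 < 1 - t := by linarith [ht.2]
    rw [← ENNReal.ofReal_mul (by positivity)]
    refine ENNReal.ofReal_le_ofReal ?_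
    calc ‖e f t‖ ^ 2 ≤ (K / √(1 - t) * ‖f‖) ^ 2 := pow_le_pow_left₀ (norm_nonneg _) (heK f t ht) 2
      _ = _ := by rw [mul_pow, div_pow, Real.sq_sqrt hy.le]; ring
  have hmem : ∀ f, MemLp (e f) 2 μ := by
    intro f
    rw [memLp_two_iff_integrable_sq_norm (hmeas f)]
    refine ⟨(hmeas f).norm.pow 2, ?_⟩
    rw [hasFiniteIntegral_iff_ofReal (Filter.Eventually.of_forall fun _ => by positivity)]
    exact (hle f).trans_lt (ENNReal.mul_lt_top ENNReal.ofReal_lt_top hD)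
  set L : muntzSpace Λ →ₗ[ℂ] Lp ℂ 2 μ :=
    { toFun := fun f => (hmem f).toLp (e f)
      map_add' := fun f g => by
        rw [← MemLp.toLp_add]
        exact MemLp.toLp_congr _ _ (by rw [map_add])
      map_smul' := fun c f => by
        rw [RingHom.id_apply, ← MemLp.toLp_const_smul]
        exact MemLp.toLp_congr _ _ (by rw [map_smul]) } with hL
  refine ⟨L.mkContinuous (K * √D.toReal) fun f => ?_, fun f =>
    ⟨e f, he f, (hmem f).coeFn_toLp⟩⟩
  have h1 : ENNReal.ofReal (‖L f‖ ^ 2) ≤ ENNReal.ofReal ((K * √D.toReal * ‖f‖) ^ 2) := by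
    rw [enorm_sq_eq_lintegral (h := L f) (hmem f).coeFn_toLp]
    refine (hle f).trans (le_of_eq ?_)
    rw [mul_right_comm, mul_pow _ (√_), Real.sq_sqrt ENNReal.toReal_nonneg,
      ENNReal.ofReal_mul (by positivity), ENNReal.ofReal_toReal hD.ne]
  exact le_of_sq_le_sq ((ENNReal.ofReal_le_ofReal_iff (by positivity)).1 h1) (by positivity)

end Upper

theorem lintegral_le_of_isHilbertSchmidt (hΛ : IsQuasiGeometric Λ) {δ : ℝ} (hδ : δ ∈ Ioo (0 : ℝ) 1) :
    ∃ c : ℝ, 0 < c ∧ ∀ μ : Measure ℝ, μ (Ico (0 : ℝ) 1)ᶜ = 0 →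
      ∀ T : muntzSpace Λ →L[ℂ] Lp ℂ 2 μ, IsCarlesonEmbedding Λ μ T → IsHilbertSchmidt T →
        ENNReal.ofReal c * ∫⁻ t in Ico δ 1, ENNReal.ofReal (1 / (1 - t)) ∂μ
          ≤ ENNReal.ofReal (∑' n, approxNumber T (n + 1) ^ (2 : ℝ)) := by
  obtain ⟨ρ, hρ, hρ1, hΛρ, hwρ, R, hR⟩ := hΛ.exists_lacunary
  have h0 := hΛ.1
  have hw0 : ∀ n, 0 < Λ n + 1 / 2 := fun n => by have := h0 n; positivity
  have hσ : 0 < √ρ := Real.sqrt_pos.2 hρ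
  have hσ1 : √ρ < 1 := by rw [Real.sqrt_lt' one_pos]; simpa using hρ1
  have hσ2 : 0 < 1 - √ρ := by linarith
  obtain ⟨c, hc, hcS⟩ := exists_le_mul_rpow hρ hρ1 h0 hΛρ hR hδ.1
  set v : ℕ → muntzSpace Λ := fun n => ⟨rpowL2 (h0 n),
    Submodule.le_topologicalClosure _ (Submodule.subset_span ⟨n, coeFn_rpowL2 (h0 n)⟩)⟩ with hv
  -- This weight gives every `g n` the same norm `1 / √2`, and Gram entries `√(wᵢ wⱼ) / (wᵢ + wⱼ)`.
  set g : ℕ → muntzSpace Λ := fun n => ((√(Λ n + 1 / 2) : ℝ) : ℂ) • v n with hg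
  have hgram : ∀ i j, ‖(inner ℂ (g i) (g j) : ℂ)‖ ≤ 1 * √ρ ^ Nat.dist i j := by
    intro i j
    have hij : (inner ℂ (v i) (v j) : ℂ)
        = ((1 / (Λ i + 1 / 2 + (Λ j + 1 / 2)) : ℝ) : ℂ) := inner_rpowL2 (h0 i) (h0 j)
    have hi := hw0 i
    have hj := hw0 j
    have h2 : (inner ℂ (g i) (g j) : ℂ) = ((√((Λ i + 1 / 2) * (Λ j + 1 / 2))
        / (Λ i + 1 / 2 + (Λ j + 1 / 2)) : ℝ) : ℂ) := by
      refine (inner_ofReal_smul_smul _ _ (v i) (v j)).trans ?_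
      rw [hij, Real.sqrt_mul hi.le]
      push_cast; ring
    rw [h2, Complex.norm_real, Real.norm_of_nonneg (by positivity), one_mul,
      div_le_iff₀ (by positivity)]
    exact sqrt_mul_le_pow_dist hρ.le hw0 hwρ i j
  set B := 1 * (2 / (1 - √ρ)) with hB
  have hB0 : 0 < B := by positivity
  have hbessel : ∀ N x, ∑ k ∈ Finset.range N, ‖(inner ℂ (g k) x : ℂ)‖ ^ 2 ≤ B * ‖x‖ ^ 2 :=
    fun N x => sum_norm_inner_sq_le _ hB0.le
      (norm_sum_smul_sq_le hσ.le hσ1 zero_le_one hgram (Finset.range N)) x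
  refine ⟨c / B, by positivity, fun μ hμ T hT hHS => ?_⟩
  have hrep : ∀ n, IsMuntzRepresentative Λ (g n)
      fun t => ((√(Λ n + 1 / 2) : ℝ) : ℂ) * ((t ^ Λ n : ℝ) : ℂ) := by
    intro n
    refine ⟨?_, Pi.single n ((√(Λ n + 1 / 2) : ℝ) : ℂ), fun t _ => ?_⟩
    · refine (Lp.coeFn_smul _ (rpowL2 (h0 n))).trans ?_
      filter_upwards [coeFn_rpowL2 (h0 n)] with t ht
      rw [Pi.smul_apply, ht, smul_eq_mul]
    · convert hasSum_single n ?_ using 1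
      · simp
      · intro m hm
        simp [hm]
  have hTg : ∀ n, ENNReal.ofReal (‖T (g n)‖ ^ 2)
      = ∫⁻ t, ENNReal.ofReal ((Λ n + 1 / 2) * t ^ (2 * Λ n)) ∂μ := by
    intro n
    rw [enorm_sq_eq_lintegral (hT.ae_eq h0 hμ (hrep n))]
    refine lintegral_congr_ae ?_
    filter_upwards [ae_mem_of_measure_compl hμ] with t ht
    have htn := Real.rpow_nonneg ht.1 (Λ n)
    rw [norm_mul, Complex.norm_real, Complex.norm_real, Real.norm_of_nonneg (Real.sqrt_nonneg _),
      Real.norm_of_nonneg htn, mul_pow, Real.sq_sqrt (hw0 n).le, mul_comm 2, Real.rpow_mul ht.1,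
      Real.rpow_two]
  have hpt : ∀ t ∈ Ico δ 1, ENNReal.ofReal c * ENNReal.ofReal (1 / (1 - t))
      ≤ ∑' n, ENNReal.ofReal ((Λ n + 1 / 2) * t ^ (2 * Λ n)) := by
    intro t ht
    obtain ⟨n, hn⟩ := hcS t ht
    refine le_trans ?_ (ENNReal.le_tsum n)
    rw [← ENNReal.ofReal_mul hc.le]
    refine ENNReal.ofReal_le_ofReal (hn.trans ?_)
    have : 0 ≤ t ^ (2 * Λ n) := Real.rpow_nonneg (hδ.1.le.trans ht.1) _
    exact mul_le_mul_of_nonneg_right (by linarith) this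
  have hmain : ENNReal.ofReal c * ∫⁻ t in Ico δ 1, ENNReal.ofReal (1 / (1 - t)) ∂μ
      ≤ ENNReal.ofReal (B * ∑' n, approxNumber T (n + 1) ^ (2 : ℝ)) := by
    calc _ = ∫⁻ t in Ico δ 1, ENNReal.ofReal c * ENNReal.ofReal (1 / (1 - t)) ∂μ :=
          (lintegral_const_mul' _ _ ENNReal.ofReal_ne_top).symm
      _ ≤ ∫⁻ t in Ico δ 1, ∑' n, ENNReal.ofReal ((Λ n + 1 / 2) * t ^ (2 * Λ n)) ∂μ :=
          setLIntegral_mono' measurableSet_Ico hpt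
      _ ≤ ∫⁻ t, ∑' n, ENNReal.ofReal ((Λ n + 1 / 2) * t ^ (2 * Λ n)) ∂μ :=
          setLIntegral_le_lintegral _ _
      _ = ∑' n, ∫⁻ t, ENNReal.ofReal ((Λ n + 1 / 2) * t ^ (2 * Λ n)) ∂μ := by
          refine lintegral_tsum fun n => ?_
          refine (Continuous.measurable ?_).ennreal_ofReal.aemeasurable
          have := h0 n
          exact continuous_const.mul (Real.continuous_rpow_const (by positivity))
      _ ≤ _ := by
          refine ENNReal.tsum_le_of_sum_range_le fun N => ?_
          simp_rw [← hTg]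
          rw [← ENNReal.ofReal_sum_of_nonneg fun _ _ => by positivity]
          exact ENNReal.ofReal_le_ofReal
            (sum_norm_sq_le_tsum_approxNumber T hHS g N (hbessel N) hB0.le)
  rw [div_eq_inv_mul, ENNReal.ofReal_mul (by positivity), mul_assoc]
  refine (mul_le_mul_right hmain _).trans (le_of_eq ?_)
  rw [← ENNReal.ofReal_mul (by positivity), inv_mul_cancel_left₀ hB0.ne']

theorem setIntegral_one_div_eq_toReal {δ : ℝ} :
    ∫ t in Ico δ 1, 1 / (1 - t) ∂μ
      = (∫⁻ t in Ico δ 1, ENNReal.ofReal (1 / (1 - t)) ∂μ).toReal := by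
  refine integral_eq_lintegral_of_nonneg_ae ?_ ?_
  · filter_upwards [ae_restrict_mem measurableSet_Ico] with t ht
    exact one_div_nonneg.2 (by linarith [ht.2])
  · exact (measurable_const.div (measurable_const.sub measurable_id)).aestronglyMeasurable

/-- On `[0, 1/2)` the weight is at most `2` and `μ` is finite, so only the part near `1` matters. -/
theorem lintegral_Ico_lt_top [IsFiniteMeasure μ]
    (h : ∫⁻ t in Ico (1 / 2 : ℝ) 1, ENNReal.ofReal (1 / (1 - t)) ∂μ < ⊤) :
    ∫⁻ t in Ico (0 : ℝ) 1, ENNReal.ofReal (1 / (1 - t)) ∂μ < ⊤ := by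
  rw [← Ico_union_Ico_eq_Ico (a := (0 : ℝ)) (b := 1 / 2) (c := 1) (by norm_num) (by norm_num)]
  refine (lintegral_union_le _ _ _).trans_lt (ENNReal.add_lt_top.2 ⟨?_, h⟩)
  refine setLIntegral_lt_top_of_le_nnreal (measure_ne_top _ _) ⟨2, fun t ht => ?_⟩
  refine ENNReal.ofReal_le_of_le_toReal ?_
  rw [ENNReal.coe_toReal, div_le_iff₀ (by linarith [ht.2])]
  push_cast
  linarith [ht.2]

end Carleson

end

/-! ### The characterisation and the norm equivalence. -/

theorem mainTheorem11 (Λ : ℕ → ℝ) (hΛ : IsQuasiGeometric Λ) :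
    (∀ (μ : Measure ℝ) [IsFiniteMeasure μ], μ (Ico (0 : ℝ) 1)ᶜ = 0 →
      ((∃ T : muntzSpace Λ →L[ℂ] Lp ℂ 2 μ, IsCarlesonEmbedding Λ μ T ∧ IsHilbertSchmidt T) ↔
        ∫⁻ t in Ico (0 : ℝ) 1, ENNReal.ofReal (1 / (1 - t)) ∂μ < ⊤)) ∧
    ∃ C : ℝ, 0 < C ∧ ∀ δ ∈ Ioo (0 : ℝ) 1, ∃ c : ℝ, 0 < c ∧
      ∀ (μ : Measure ℝ) [IsFiniteMeasure μ], μ (Ico (0 : ℝ) 1)ᶜ = 0 →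
        ∀ T : muntzSpace Λ →L[ℂ] Lp ℂ 2 μ, IsCarlesonEmbedding Λ μ T → IsHilbertSchmidt T →
          c * (∫ t in Ico δ 1, 1 / (1 - t) ∂μ) ^ (1 / 2 : ℝ) ≤ schattenNorm T 2 ∧
          schattenNorm T 2 ≤ C * (∫ t in Ico (0 : ℝ) 1, 1 / (1 - t) ∂μ) ^ (1 / 2 : ℝ) := by
  obtain ⟨e, K, hK, he, heK⟩ := exists_muntz_evaluation hΛ
  have hpos : ∀ (μ : Measure ℝ) (T : muntzSpace Λ →L[ℂ] Lp ℂ 2 μ) (n : ℕ),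
      0 ≤ approxNumber T (n + 1) ^ (2 : ℝ) :=
    fun μ T n => Real.rpow_nonneg (approxNumber_nonneg _ _) _
  have hsum : ∀ (μ : Measure ℝ), μ (Ico (0 : ℝ) 1)ᶜ = 0 →
      ∫⁻ t in Ico (0 : ℝ) 1, ENNReal.ofReal (1 / (1 - t)) ∂μ < ⊤ →
      ∀ T : muntzSpace Λ →L[ℂ] Lp ℂ 2 μ, IsCarlesonEmbedding Λ μ T → ∀ N,
      ∑ i ∈ Finset.range N, approxNumber T (i + 1) ^ (2 : ℝ)
        ≤ 4 * K ^ 2 * (∫⁻ t in Ico (0 : ℝ) 1, ENNReal.ofReal (1 / (1 - t)) ∂μ).toReal := by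
    intro μ hμ hD T hT N
    have h1 := sum_approxNumber_sq_le hΛ.1 he heK hμ hT N
    rw [← ENNReal.ofReal_toReal hD.ne, ← ENNReal.ofReal_mul (by positivity)] at h1
    exact (ENNReal.ofReal_le_ofReal_iff (by positivity)).1 h1
  have hfin : ∀ (μ : Measure ℝ) [IsFiniteMeasure μ], μ (Ico (0 : ℝ) 1)ᶜ = 0 →
      ∀ T : muntzSpace Λ →L[ℂ] Lp ℂ 2 μ, IsCarlesonEmbedding Λ μ T → IsHilbertSchmidt T →
      ∫⁻ t in Ico (0 : ℝ) 1, ENNReal.ofReal (1 / (1 - t)) ∂μ < ⊤ := by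
    intro μ _ hμ T hT hHS
    -- Any cut-off works here; `1 / 2` is the one used in `lintegral_Ico_lt_top`.
    obtain ⟨c, hc, h⟩ := lintegral_le_of_isHilbertSchmidt hΛ (δ := 1 / 2) ⟨by norm_num, by norm_num⟩
    refine lintegral_Ico_lt_top (lt_top_iff_ne_top.2 fun htop => ?_)
    have h1 := h μ hμ T hT hHS
    rw [htop, ENNReal.mul_top (ENNReal.ofReal_pos.2 hc).ne'] at h1
    exact ENNReal.ofReal_ne_top (top_le_iff.1 h1)
  refine ⟨fun μ _ hμ => ⟨fun ⟨T, hT, hHS⟩ => hfin μ hμ T hT hHS, fun hD => ?_⟩, 2 * K, by positivity,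
    fun δ hδ => ?_⟩
  · obtain ⟨T, hT⟩ := exists_carlesonEmbedding hΛ.1 hK he heK hμ hD
    exact ⟨T, hT, summable_of_sum_range_le (hpos μ T) (hsum μ hμ hD T hT)⟩
  · obtain ⟨c, hc, h⟩ := lintegral_le_of_isHilbertSchmidt hΛ hδ
    refine ⟨c ^ (1 / 2 : ℝ), by positivity, fun μ _ hμ T hT hHS => ?_⟩
    have hS0 : 0 ≤ ∑' n, approxNumber T (n + 1) ^ (2 : ℝ) := tsum_nonneg (hpos μ T)
    rw [setIntegral_one_div_eq_toReal, setIntegral_one_div_eq_toReal, schattenNorm]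
    constructor
    · rw [← Real.mul_rpow hc.le ENNReal.toReal_nonneg]
      refine Real.rpow_le_rpow (by positivity) ?_ (by norm_num)
      have h1 := ENNReal.toReal_mono ENNReal.ofReal_ne_top (h μ hμ T hT hHS)
      rwa [ENNReal.toReal_mul, ENNReal.toReal_ofReal hc.le, ENNReal.toReal_ofReal hS0] at h1
    · have hC : 2 * K = (4 * K ^ 2) ^ (1 / 2 : ℝ) := by
        rw [← Real.sqrt_eq_rpow, show 4 * K ^ 2 = (2 * K) ^ 2 by ring, Real.sqrt_sq (by positivity)]
      rw [hC, ← Real.mul_rpow (by positivity) ENNReal.toReal_nonneg]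
      refine Real.rpow_le_rpow hS0 ?_ (by norm_num)
      exact hHS.tsum_le_of_sum_range_le (hsum μ hμ (hfin μ hμ T hT hHS) T hT)
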